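/- All graphs are finite and simple, and for a set $X$ of vertices $G-X$ denotes the graph obtained from $G$ by deleting the vertices in $X$. The connectivity $\kappa(G)$ is the minimum number of vertices whose deletion leaves a disconnected graph or a graph with at most one vertex. A graph $H$ is factor-critical if $H-v$ has a perfect matching for every $v\in V(H)$. A sun is a graph isomorphic to $K_1$, to $K_2$, or to a graph obtained from a nonempty factor-critical graph $H$ by attaching to each vertex of $H$ one new vertex of degree one; $\mathrm{sun}(G)$ denotes the number of connected components of $G$ that are suns. The sun toughness of a connected graph $G$ is $s(G)=+\infty$ if $G$ is complete, and otherwise $$s(G)=\min\left\{\frac{|X|}{\mathrm{sun}(G-X)} : X\subseteq V(G),\ \mathrm{sun}(G-X)\geq 2\right\}.$$ **Theorem.** Let $l\geq 1$ be an integer and let $G$ be a graph with $\kappa(G)\geq l+2$. If $s(G)>\frac{l+1}{3}$, then $G$ is $(P_{\geq 3},l)$-factor critical; that is, for every $V'\subseteq V(G)$ with $|V'|=l$, the graph $G-V'$ has a spanning subgraph each of whose connected components is a path with at least $3$ vertices. -/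

import Mathlib

open scoped ENNReal

namespace PathFactor

/-- The graph `G - S` obtained from `G` by deleting the vertices in `S`. -/
abbrev deleteVerts {V : Type*} (G : SimpleGraph V) (S : Finset V) :
    SimpleGraph ((S : Set V)ᶜ : Set V) :=
  G.induce ((S : Set V)ᶜ)

/-- Vertex connectivity `κ(G)` of a finite graph: the least number of vertices whose deletion
leaves a disconnected graph or at most one vertex (so `κ(K_n) = n - 1`). -/
noncomputable def vertexConnectivity {V : Type*} (G : SimpleGraph V) : ℕ :=
  sInf {k : ℕ | ∃ S : Finset V, S.card = k ∧
    (¬ (deleteVerts G S).Preconnected ∨ ((S : Set V)ᶜ).Subsingleton)}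

/-- `H` is factor-critical: for every vertex `v`, `H - v` has a 1-factor. -/
def IsFactorCritical {V : Type*} (H : SimpleGraph V) : Prop :=
  ∀ v : V, ∃ M : (deleteVerts H {v}).Subgraph, M.IsPerfectMatching

/-- The graph obtained from `H` by attaching to each vertex `v` (that is, `Sum.inl v`) one new
pendant vertex (that is, `Sum.inr v`). -/
def addPendants {V : Type*} (H : SimpleGraph V) : SimpleGraph (V ⊕ V) where
  Adj
    | Sum.inl a, Sum.inl b => H.Adj a b
    | Sum.inl a, Sum.inr b => a = b
    | Sum.inr a, Sum.inl b => a = b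
    | Sum.inr _, Sum.inr _ => False
  symm := ⟨by
    rintro (a | a) (b | b) h
    · exact SimpleGraph.Adj.symm h
    · exact Eq.symm h
    · exact Eq.symm h
    · exact h⟩
  loopless := ⟨by
    rintro (a | a) h
    · exact H.irrefl h
    · exact h⟩

/-- A finite graph is a sun if it is isomorphic to `K_1`, to `K_2`, or to a graph obtained from a
(nonempty) factor-critical graph by attaching one pendant vertex to each vertex. -/
def IsSun {V : Type*} (G : SimpleGraph V) : Prop :=
  Nonempty (G ≃g (⊤ : SimpleGraph (Fin 1))) ∨
  Nonempty (G ≃g (⊤ : SimpleGraph (Fin 2))) ∨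
  ∃ (n : ℕ) (H : SimpleGraph (Fin n)), 1 ≤ n ∧ IsFactorCritical H ∧ Nonempty (G ≃g addPendants H)

/-- `sun(G)`: the number of components of `G` that are suns. -/
noncomputable def sun {V : Type*} (G : SimpleGraph V) : ℕ :=
  Nat.card {C : G.ConnectedComponent // IsSun C.toSimpleGraph}

open scoped Classical in
/-- The sun toughness `s(G)` of a finite connected graph: `+∞` if `G` is complete, and otherwise
the minimum of `|X| / sun(G - X)` over all `X ⊆ V(G)` with `sun(G - X) ≥ 2`. -/
noncomputable def sunToughness {V : Type*} (G : SimpleGraph V) : ℝ≥0∞ :=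
  if G = ⊤ then ⊤
  else ⨅ (X : Finset V) (_ : 2 ≤ sun (deleteVerts G X)),
    (X.card : ℝ≥0∞) / (sun (deleteVerts G X) : ℝ≥0∞)

/-- `G` has a `P_{≥ k}`-factor: a spanning subgraph each of whose components is isomorphic to a
path of order at least `k`. -/
def HasPathFactor {V : Type*} (k : ℕ) (G : SimpleGraph V) : Prop :=
  ∃ F : SimpleGraph V, F ≤ G ∧
    ∀ C : F.ConnectedComponent, ∃ n : ℕ, k ≤ n ∧
      Nonempty (C.toSimpleGraph ≃g SimpleGraph.pathGraph n)

/-- `G` is `(P_{≥ k}, l)`-factor critical. -/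
def IsPathFactorCritical {V : Type*} (k l : ℕ) (G : SimpleGraph V) : Prop :=
  ∀ V' : Finset V, V'.card = l → HasPathFactor k (deleteVerts G V')

end PathFactor

/-! The theorem rests on Kaneko's criterion (`SunCond.pathCover`): a graph has a factor of paths of
order at least 3 as soon as sun(G - S) ≤ 2|S| for every vertex set S. Suppose some S violates this
in G - V'. If S is empty, the connected graph G - V' is itself a sun. It is not K_1, and deleting
one core vertex isolates a pendant one, against κ ≥ l + 2. If S is nonempty, then X = V' ∪ S leaves
at least 2|S| + 1 suns, and (l + |S|)/(2|S| + 1) ≤ (l + 1)/3 contradicts the toughness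
(`sunCond_of_toughness`).

Kaneko's criterion is proved by induction on vertices and edges; the graph may be assumed connected.
If some nonempty S is tight, sun(G - S) = 2|S|, Hall's theorem gives each vertex of S two suns of
its own. Each such triple has a path cover, and the sun-free remainder inherits the condition
(`pathCover_of_tight`).

Without tight sets, suppose first that every vertex is a leaf or carries one. The graph is then a
core H with one leaf per core vertex. A perfect matching of H gives paths of order 4; otherwise the
Gallai form of Tutte's theorem (`hasPM_or_exists_violator`) gives a set whose deletion leaves too
many suns.

In the remaining case some x is neither a leaf nor next to one. Delete an edge xy. If the condition
survives, induction applies. If it fails at a nonempty S, the deletion created exactly two suns,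
joined by the bridge xy, and sun(G - S) = 2|S| - 1. Hall's theorem with capacity 1 at one s ∈ S and
2 elsewhere covers all but s, one sun next to s and the two new suns; these are covered by hand
(`Reduced.pathCover_of_cut`). Failure at the empty set is treated directly
(`Reduced.pathCover_of_sun_delEdge`).

Throughout, vertex sets of one ambient graph replace induced subgraphs, and K_2 counts as the corona
of K_1. -/

namespace PathFactor

/-! ### Components of induced subgraphs and their assignment to cut vertices -/

variable {V : Type*}

/-- `B` is a union of connected components of the subgraph of `G` induced on `A`. -/
def Closed (G : SimpleGraph V) (A B : Finset V) : Prop :=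
  B ⊆ A ∧ ∀ a ∈ B, ∀ b ∈ A, G.Adj a b → b ∈ B

/-- `C` is the vertex set of a connected component of the subgraph of `G` induced on `A`. -/
def IsComp (G : SimpleGraph V) (A C : Finset V) : Prop :=
  Closed G A C ∧ C.Nonempty ∧ ∀ B, Closed G A B → B ⊆ C → B.Nonempty → B = C

open scoped Classical in
/-- The components of `G[A]` with the property `p`. -/
noncomputable def comps (G : SimpleGraph V) (p : Finset V → Prop) (A : Finset V) :
    Finset (Finset V) :=
  A.powerset.filter fun C => IsComp G A C ∧ p C

/-- The number of components of `G[A]` with the property `p`. -/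
noncomputable def cnt (G : SimpleGraph V) (p : Finset V → Prop) (A : Finset V) : ℕ :=
  (comps G p A).card

variable {G : SimpleGraph V} {A B C S : Finset V} {p : Finset V → Prop}

theorem mem_comps : C ∈ comps G p A ↔ IsComp G A C ∧ p C := by
  simp only [comps, Finset.mem_filter, Finset.mem_powerset, and_iff_right_iff_imp]
  exact fun h => h.1.1.1

theorem Closed.refl (G : SimpleGraph V) (A : Finset V) : Closed G A A :=
  ⟨subset_rfl, fun _ _ _ hb _ => hb⟩

theorem Closed.iff_of_subset (hB : Closed G A B) (hC : C ⊆ B) :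
    Closed G A C ↔ Closed G B C :=
  ⟨fun h => ⟨hC, fun a ha b hb hab => h.2 a ha b (hB.1 hb) hab⟩,
    fun h => ⟨hC.trans hB.1, fun a ha b hb hab => h.2 a ha b (hB.2 a (hC ha) b hb hab) hab⟩⟩

theorem Closed.mono (hB : Closed G A C) (h : C ⊆ B) (hBA : B ⊆ A) : Closed G B C :=
  ⟨h, fun a ha b hb hab => hB.2 a ha b (hBA hb) hab⟩

theorem Closed.isComp_iff (hB : Closed G A B) (hC : C ⊆ B) :
    IsComp G A C ↔ IsComp G B C := by
  unfold IsComp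
  rw [hB.iff_of_subset hC]
  refine and_congr_right fun _ => and_congr_right fun _ => forall_congr' fun D => ?_
  constructor
  · exact fun h h1 h2 => h ((hB.iff_of_subset (h2.trans hC)).2 h1) h2
  · exact fun h h1 h2 => h ((hB.iff_of_subset (h2.trans hC)).1 h1) h2

/-- A component which is closed in a larger vertex set is a component there. -/
theorem IsComp.of_closed (hC : IsComp G A C) (h : Closed G B C) : IsComp G B C := by
  rw [h.isComp_iff subset_rfl]
  exact (hC.1.isComp_iff subset_rfl).1 hC

theorem comps_congr {G' : SimpleGraph V} {p' : Finset V → Prop}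
    (h : ∀ a ∈ A, ∀ b ∈ A, G.Adj a b ↔ G'.Adj a b) (hp : ∀ C ⊆ A, p C ↔ p' C) :
    comps G p A = comps G' p' A := by
  have hcl : ∀ B, Closed G A B ↔ Closed G' A B := fun B =>
    and_congr_right fun hB => forall_congr' fun a => forall_congr' fun ha => forall_congr' fun b =>
      forall_congr' fun hb => by rw [h a (hB ha) b hb]
  ext C
  rw [mem_comps, mem_comps]
  unfold IsComp
  simp only [hcl]
  constructor
  · rintro ⟨h1, h2⟩
    exact ⟨h1, (hp C h1.1.1).1 h2⟩
  · rintro ⟨h1, h2⟩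
    exact ⟨h1, (hp C h1.1.1).2 h2⟩

theorem card_le_cnt {F : Finset (Finset V)} (h : ∀ C ∈ F, IsComp G A C ∧ p C) :
    F.card ≤ cnt G p A :=
  Finset.card_le_card fun C hC => mem_comps.2 (h C hC)

theorem cnt_eq_zero_iff : cnt G p A = 0 ↔ ∀ C, IsComp G A C → ¬ p C := by
  unfold cnt
  rw [Finset.card_eq_zero, Finset.eq_empty_iff_forall_notMem]
  exact forall_congr' fun C => by rw [mem_comps, not_and]

theorem isComp_self_iff : IsComp G A A ↔ A.Nonempty ∧ ∀ B, Closed G A B → B.Nonempty → B = A :=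
  ⟨fun h => ⟨h.2.1, fun B hB => h.2.2 B hB hB.1⟩,
    fun h => ⟨Closed.refl G A, h.1, fun B hB _ => h.2 B hB⟩⟩

theorem IsComp.isComp_self (h : IsComp G A C) : IsComp G C C := (h.1.isComp_iff subset_rfl).1 h

theorem one_le_cnt (h : IsComp G A C) (hp : p C) : 1 ≤ cnt G p A := by
  simpa using card_le_cnt (F := {C}) (G := G) (A := A) (p := p) (by simp [h, hp])

variable [DecidableEq V]

theorem Closed.sdiff (h : Closed G A B) : Closed G A (A \ B) := by
  refine ⟨Finset.sdiff_subset, fun a ha b hb hab => ?_⟩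
  rw [Finset.mem_sdiff] at ha ⊢
  exact ⟨hb, fun hbB => ha.2 (h.2 b hbB a ha.1 hab.symm)⟩

theorem Closed.delete (hB : Closed G A B) (X : Finset V) : Closed G (A \ X) (B \ X) := by
  refine ⟨Finset.sdiff_subset_sdiff hB.1 subset_rfl, fun a ha b hb hab => ?_⟩
  rw [Finset.mem_sdiff] at *
  exact ⟨hB.2 a ha.1 b hb.1 hab, hb.2⟩

theorem Closed.inter (hB : Closed G A B) (hC : Closed G A C) : Closed G A (B ∩ C) := by
  refine ⟨Finset.inter_subset_left.trans hB.1, fun a ha b hb hab => ?_⟩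
  rw [Finset.mem_inter] at ha ⊢
  exact ⟨hB.2 a ha.1 b hb hab, hC.2 a ha.2 b hb hab⟩

theorem Closed.union (hB : Closed G A B) (hC : Closed G A C) : Closed G A (B ∪ C) := by
  refine ⟨Finset.union_subset hB.1 hC.1, fun a ha b hb hab => ?_⟩
  rw [Finset.mem_union] at ha ⊢
  exact ha.imp (fun h => hB.2 a h b hb hab) fun h => hC.2 a h b hb hab

theorem IsComp.subset_of_mem (hC : IsComp G A C) (hB : Closed G A B) {v : V} (hv : v ∈ C)
    (hvB : v ∈ B) : C ⊆ B := by
  have := hC.2.2 (C ∩ B) (hC.1.inter hB) Finset.inter_subset_left ⟨v, by simp [hv, hvB]⟩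
  exact Finset.inter_eq_left.1 this

theorem IsComp.eq_of_mem (hC : IsComp G A C) (hB : IsComp G A B) {v : V} (hv : v ∈ C)
    (hvB : v ∈ B) : C = B :=
  (hC.subset_of_mem hB.1 hv hvB).antisymm (hB.subset_of_mem hC.1 hvB hv)

theorem IsComp.disjoint (hC : IsComp G A C) (hB : IsComp G A B) (h : C ≠ B) : Disjoint C B :=
  Finset.disjoint_left.2 fun _ hv hvB => h (hC.eq_of_mem hB hv hvB)

theorem exists_isComp {v : V} (hv : v ∈ A) : ∃ C, IsComp G A C ∧ v ∈ C := by
  classical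
  obtain ⟨C, hC, hmin⟩ := (A.powerset.filter fun B => Closed G A B ∧ v ∈ B).exists_min_image
    Finset.card ⟨A, by simp [Closed.refl, hv]⟩
  simp only [Finset.mem_filter, Finset.mem_powerset] at hC hmin
  refine ⟨C, ⟨hC.2.1, ⟨v, hC.2.2⟩, fun B hB hBC hne => ?_⟩, hC.2.2⟩
  by_cases hvB : v ∈ B
  · exact Finset.eq_of_subset_of_card_le hBC (hmin B ⟨hB.1, hB, hvB⟩)
  · have hcl : Closed G A (C \ B) := by
      have := hC.2.1.inter hB.sdiff
      rwa [← Finset.inter_sdiff_assoc, Finset.inter_eq_left.2 hC.1] at this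
    have h1 := hmin (C \ B) ⟨hcl.1, hcl, by simp [hC.2.2, hvB]⟩
    have h2 := Finset.card_sdiff_add_card_eq_card hBC
    have h3 := hne.card_pos
    omega

theorem cnt_add_cnt (hB : Closed G A B) : cnt G p A = cnt G p B + cnt G p (A \ B) := by
  unfold cnt
  rw [← Finset.card_union_of_disjoint]
  · congr 1
    ext C
    rw [Finset.mem_union, mem_comps, mem_comps, mem_comps]
    constructor
    · rintro ⟨h, hp⟩
      obtain ⟨v, hv⟩ := h.2.1
      by_cases hvB : v ∈ B
      · exact Or.inl ⟨(hB.isComp_iff (h.subset_of_mem hB hv hvB)).1 h, hp⟩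
      · have : v ∈ A \ B := Finset.mem_sdiff.2 ⟨h.1.1 hv, hvB⟩
        exact Or.inr ⟨(hB.sdiff.isComp_iff (h.subset_of_mem hB.sdiff hv this)).1 h, hp⟩
    · rintro (⟨h, hp⟩ | ⟨h, hp⟩)
      · exact ⟨(hB.isComp_iff h.1.1).2 h, hp⟩
      · exact ⟨(hB.sdiff.isComp_iff h.1.1).2 h, hp⟩
  · rw [Finset.disjoint_left]
    intro C h1 h2
    rw [mem_comps] at h1 h2
    obtain ⟨v, hv⟩ := h1.1.2.1
    exact (Finset.mem_sdiff.1 (h2.1.1.1 hv)).2 (h1.1.1.1 hv)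

/-- The union of the components of `G[A]` with the property `p`. -/
noncomputable def compUnion (G : SimpleGraph V) (p : Finset V → Prop) (A : Finset V) : Finset V :=
  (comps G p A).biUnion id

theorem closed_compUnion : Closed G A (compUnion G p A) := by
  constructor
  · intro v hv
    obtain ⟨C, hC, hv⟩ := Finset.mem_biUnion.1 hv
    exact (mem_comps.1 hC).1.1.1 hv
  · intro v hv b hb hab
    obtain ⟨C, hC, hv⟩ := Finset.mem_biUnion.1 hv
    exact Finset.mem_biUnion.2 ⟨C, hC, (mem_comps.1 hC).1.1.2 v hv b hb hab⟩

theorem cnt_sdiff_compUnion : cnt G p (A \ compUnion G p A) = 0 := by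
  rw [cnt_eq_zero_iff]
  intro C hC hp
  have h : IsComp G A C := (closed_compUnion.sdiff.isComp_iff hC.1.1).2 hC
  obtain ⟨v, hv⟩ := hC.2.1
  exact (Finset.mem_sdiff.1 (hC.1.1 hv)).2 (Finset.mem_biUnion.2 ⟨C, mem_comps.2 ⟨h, hp⟩, hv⟩)

/-- All counted components avoid `B`, so deleting `X` from `B` keeps them and adds those of `B \ X`.
This passes a counting condition from the whole graph to what remains once the counted components
are used up. -/
theorem cnt_sdiff_of_cnt_eq_zero {X : Finset V} (hB : Closed G A B) (h0 : cnt G p B = 0)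
    (hX : X ⊆ B) : cnt G p (A \ X) = cnt G p A + cnt G p (B \ X) := by
  have h1 := cnt_add_cnt (p := p) hB
  have h2 := cnt_add_cnt (p := p) (hB.delete X)
  have : (A \ X) \ (B \ X) = A \ B := by grind
  rw [this] at h2
  omega

/-- Hall's theorem with capacities: each `s` is replaced by `c s` clones, and an injective choice of
clones is projected back. -/
theorem exists_assignment [Nonempty V] {F : Finset (Finset V)} {r : Finset V → Finset V}
    {c : V → ℕ} (h : ∀ F' ⊆ F, F'.card ≤ ∑ s ∈ F'.biUnion r, c s) :
    ∃ f : Finset V → V, (∀ K ∈ F, f K ∈ r K) ∧ ∀ s, (F.filter (f · = s)).card ≤ c s := by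
  classical
  let t : F → Finset (Σ _ : V, ℕ) := fun K => (r K.1).sigma fun s => Finset.range (c s)
  have hall : ∀ F' : Finset F, F'.card ≤ (F'.biUnion t).card := by
    intro F'
    have h1 := h (F'.map (Function.Embedding.subtype _)) (by
      intro K hK
      simp only [Finset.mem_map, Function.Embedding.subtype_apply] at hK
      obtain ⟨K', _, rfl⟩ := hK
      exact K'.2)
    rw [Finset.card_map] at h1
    refine h1.trans (le_of_eq ?_)
    rw [show F'.biUnion t = ((F'.map (Function.Embedding.subtype _)).biUnion r).sigma
      fun s => Finset.range (c s) by ext; simp [t]; grind, Finset.card_sigma]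
    simp
  obtain ⟨g, hg, hgt⟩ := (Finset.all_card_le_biUnion_card_iff_exists_injective t).1 hall
  let f : Finset V → V := fun K =>
    if hK : K ∈ F then (g ⟨K, hK⟩).1 else Classical.arbitrary V
  have hf : ∀ K (hK : K ∈ F), f K = (g ⟨K, hK⟩).1 := fun K hK => by simp [f, hK]
  refine ⟨f, fun K hK => ?_, fun s => ?_⟩
  · rw [hf K hK]
    exact (Finset.mem_sigma.1 (hgt ⟨K, hK⟩)).1
  · rw [← Finset.card_range (c s)]
    refine Finset.card_le_card_of_injOn
      (fun K => if hK : K ∈ F then (g ⟨K, hK⟩).2 else 0) ?_ ?_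
    · intro K hK
      simp only [Finset.coe_filter, Set.mem_ofPred_eq] at hK
      have h1 := (Finset.mem_sigma.1 (hgt ⟨K, hK.1⟩)).2
      have h2 := (hf K hK.1).symm.trans hK.2
      rw [Finset.mem_range, h2] at h1
      simpa [hK.1] using h1
    · intro K hK L hL hKL
      simp only [Finset.coe_filter, Set.mem_ofPred_eq] at hK hL
      simp only [hK.1, hL.1, dif_pos] at hKL
      have h1 : (g ⟨K, hK.1⟩).1 = (g ⟨L, hL.1⟩).1 := by
        rw [← hf K hK.1, ← hf L hL.1, hK.2, hL.2]
      have h2 : g ⟨K, hK.1⟩ = g ⟨L, hL.1⟩ := Sigma.ext h1 (heq_of_eq hKL)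
      exact congrArg Subtype.val (hg h2)

/-- If deleting `T ⊆ S` never creates too many components with the property `p`, and deleting `S`
creates as many as `c` allows, then these components can be distributed among adjacent vertices of
`S`, exactly `c s` of them to each `s ∈ S`. -/
theorem exists_comps_assignment [Nonempty V] {c : V → ℕ}
    (h : ∀ T ⊆ S, cnt G p (A \ T) ≤ ∑ s ∈ T, c s) (hS : cnt G p (A \ S) = ∑ s ∈ S, c s) :
    ∃ f : Finset V → V,
      (∀ K ∈ comps G p (A \ S), f K ∈ S ∧ ∃ v ∈ K, G.Adj (f K) v) ∧
      ∀ s ∈ S, ((comps G p (A \ S)).filter (f · = s)).card = c s := by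
  classical
  obtain ⟨f, hf, hc⟩ := exists_assignment (F := comps G p (A \ S))
    (r := fun K => S.filter fun s => ∃ v ∈ K, G.Adj s v) (c := c) (by
      intro F' hF'
      refine le_trans (card_le_cnt fun C hC => ?_) (h _ ?_)
      -- Hall's condition: a component in `F'` has no neighbours in `S` outside the neighbourhood of
      -- `F'`, so it stays a component when only that neighbourhood is deleted.
      · have hC' := mem_comps.1 (hF' hC)
        refine ⟨hC'.1.of_closed ⟨?_, ?_⟩, hC'.2⟩
        · intro v hv
          have := hC'.1.1.1 hv
          grind
        · intro a ha b hb hab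
          refine hC'.1.1.2 a ha b ?_ hab
          simp only [Finset.mem_sdiff, Finset.mem_biUnion, Finset.mem_filter, not_exists,
            not_and] at hb ⊢
          exact ⟨hb.1, fun hbS => hb.2 C hC hbS a ha hab.symm⟩
      · intro s hs
        grind)
  have hf' : ∀ K ∈ comps G p (A \ S), f K ∈ S ∧ ∃ v ∈ K, G.Adj (f K) v := fun K hK =>
    Finset.mem_filter.1 (hf K hK)
  refine ⟨f, hf', ?_⟩
  have hsum : ∑ s ∈ S, ((comps G p (A \ S)).filter (f · = s)).card = ∑ s ∈ S, c s := by
    rw [← hS, cnt, Finset.card_eq_sum_card_fiberwise (f := f) (t := S)]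
    exact fun K hK => (hf' K hK).1
  -- No fibre exceeds its capacity and the totals agree, so every capacity is attained.
  exact (Finset.sum_eq_sum_iff_of_le fun s _ => hc s).1 hsum

/-- The vertex `s` together with the components of `G[A]` assigned to it by `f`. -/
noncomputable def star (G : SimpleGraph V) (p : Finset V → Prop) (A : Finset V)
    (f : Finset V → V) (s : V) : Finset V :=
  insert s (((comps G p A).filter (f · = s)).biUnion id)

theorem mem_star {f : Finset V → V} {s v : V} :
    v ∈ star G p A f s ↔ v = s ∨ ∃ K ∈ comps G p A, f K = s ∧ v ∈ K := by
  simp [star, and_assoc]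

theorem disjoint_star {f : Finset V → V} {s t : V} (hs : s ∈ S) (ht : t ∈ S) (hst : s ≠ t) :
    Disjoint (star G p (A \ S) f s) (star G p (A \ S) f t) := by
  rw [Finset.disjoint_left]
  intro v hv hv'
  rw [mem_star] at hv hv'
  have key : ∀ K ∈ comps G p (A \ S), v ∈ K → v ∉ S := fun K hK hvK =>
    (Finset.mem_sdiff.1 ((mem_comps.1 hK).1.1.1 hvK)).2
  rcases hv with rfl | ⟨K, hK, hKs, hvK⟩
  · rcases hv' with rfl | ⟨L, hL, hLt, hvL⟩
    · exact hst rfl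
    · exact key L hL hvL hs
  · rcases hv' with rfl | ⟨L, hL, hLt, hvL⟩
    · exact key K hK hvK ht
    · have := (mem_comps.1 hK).1.eq_of_mem (mem_comps.1 hL).1 hvK hvL
      subst this
      exact hst (hKs.symm.trans hLt)

theorem biUnion_star {f : Finset V → V} (hf : ∀ K ∈ comps G p (A \ S), f K ∈ S) :
    S.biUnion (star G p (A \ S) f) = S ∪ compUnion G p (A \ S) := by
  ext v
  simp only [Finset.mem_biUnion, mem_star, Finset.mem_union, compUnion, id]
  grind

/-- Stars of different vertices are disjoint; this glues their perfect matchings, and later their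
path covers. -/
theorem biUnion_induction {Q : Finset V → Prop} (h0 : Q ∅)
    (hU : ∀ A B, Disjoint A B → Q A → Q B → Q (A ∪ B)) {t : V → Finset V}
    (hd : ∀ a ∈ S, ∀ b ∈ S, a ≠ b → Disjoint (t a) (t b)) (h : ∀ a ∈ S, Q (t a)) :
    Q (S.biUnion t) := by
  induction S using Finset.induction_on with
  | empty => simpa using h0
  | insert a S ha ih =>
    rw [Finset.biUnion_insert]
    refine hU _ _ ?_ (h a (by simp)) (ih (fun b hb c hc => hd b (by simp [hb]) c (by simp [hc]))
      fun b hb => h b (by simp [hb]))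
    rw [Finset.disjoint_biUnion_right]
    intro b hb
    exact hd a (by simp) b (by simp [hb]) (by rintro rfl; exact ha hb)

end PathFactor

/-! ### Perfect matchings and the Gallai form of Tutte's theorem -/

namespace PathFactor

variable {V : Type*}

/-- `G[A]` has a perfect matching, given as an involution. -/
def HasPM (G : SimpleGraph V) (A : Finset V) : Prop :=
  ∃ m : V → V, ∀ a ∈ A, m a ∈ A ∧ m (m a) = a ∧ G.Adj a (m a)

theorem HasPM.empty {G : SimpleGraph V} : HasPM G ∅ := ⟨id, by simp⟩

variable [DecidableEq V]

/-- `G[C]` is factor-critical. -/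
def FactorCritical (G : SimpleGraph V) (C : Finset V) : Prop :=
  ∀ v ∈ C, HasPM G (C.erase v)

variable {G : SimpleGraph V} {A B C S : Finset V}

theorem HasPM.pair {a b : V} (h : G.Adj a b) : HasPM G {a, b} := by
  refine ⟨fun v => if v = a then b else a, ?_⟩
  have := h.ne
  have := h.symm
  grind

theorem HasPM.union (hd : Disjoint A B) (hA : HasPM G A) (hB : HasPM G B) :
    HasPM G (A ∪ B) := by
  obtain ⟨m, hm⟩ := hA
  obtain ⟨n, hn⟩ := hB
  rw [Finset.disjoint_left] at hd
  refine ⟨fun v => if v ∈ A then m v else n v, fun v hv => ?_⟩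
  by_cases hvA : v ∈ A
  · have := hm v hvA
    grind
  · have := hn v (by grind)
    grind

theorem sdiff_pair_of_matching {m : V → V}
    (hm : ∀ a ∈ A, m a ∈ A ∧ m (m a) = a ∧ G.Adj a (m a)) {a : V} (ha : a ∈ A) :
    HasPM G (A \ {a, m a}) := by
  refine ⟨m, fun b hb => ?_⟩
  have h1 := hm a ha
  have h2 := hm b (by grind)
  grind

theorem hasPM_insert {s v : V} (hs : s ∉ C) (hv : v ∈ C) (h : G.Adj s v)
    (hC : FactorCritical G C) : HasPM G (insert s C) := by
  have := HasPM.union (A := {s, v}) (B := C.erase v) (by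
    rw [Finset.disjoint_left]; grind) (HasPM.pair h) (hC v hv)
  convert this using 1
  grind

/-- Tutte's theorem in the form of Gallai: a graph without a perfect matching has a vertex set whose
deletion leaves more factor-critical components than vertices were deleted. -/
theorem hasPM_or_exists_violator (A : Finset V) :
    HasPM G A ∨ ∃ S ⊆ A, S.card < cnt G (FactorCritical G) (A \ S) := by
  induction A using Finset.strongInduction with
  | H A ih =>
  by_contra! hcon
  obtain ⟨hA, hS⟩ := hcon
  have hne : A.Nonempty := by
    by_contra h
    rw [Finset.not_nonempty_iff_eq_empty] at h
    exact hA (h ▸ HasPM.empty)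
  have sub : ∀ B, B ⊂ A → (∀ X ⊆ B, cnt G (FactorCritical G) (B \ X) ≤ X.card) → HasPM G B := by
    intro B hB h
    refine (ih B hB).resolve_right ?_
    rintro ⟨X, hX, hlt⟩
    have := h X hX
    omega
  have hconn : IsComp G A A := by
    obtain ⟨v, hv⟩ := hne
    obtain ⟨C, hC, hvC⟩ := exists_isComp (G := G) hv
    by_cases hCA : C = A
    · rwa [hCA] at hC
    · refine absurd ?_ hA
      have split : ∀ B, Closed G A B → B ⊂ A → HasPM G B := by
        intro B hB hBA
        refine sub B hBA fun X hX => ?_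
        have h1 := cnt_add_cnt (p := FactorCritical G) (hB.delete X)
        have h2 := hS X (hX.trans hB.1)
        omega
      have h1 := split C hC.1 (Finset.ssubset_iff_subset_ne.2 ⟨hC.1.1, hCA⟩)
      have h2 := split (A \ C) hC.1.sdiff (Finset.sdiff_ssubset hC.1.1 hC.2.1)
      have h3 := h1.union Finset.disjoint_sdiff h2
      rwa [Finset.union_sdiff_of_subset hC.1.1] at h3
  -- In a minimal counterexample no nonempty set attains equality: otherwise Hall's theorem matches
  -- each vertex of `S` into a factor-critical component of its own, and the remainder has a perfect
  -- matching by induction.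
  have slack : ∀ S ⊆ A, S.Nonempty → cnt G (FactorCritical G) (A \ S) < S.card := by
    intro S hSA hSne
    refine lt_of_le_of_ne (hS S hSA) fun heq => hA ?_
    have : Nonempty V := ⟨hSne.choose⟩
    obtain ⟨f, hf, hfc⟩ := exists_comps_assignment (G := G) (p := FactorCritical G) (A := A)
      (S := S) (c := fun _ => 1) (fun T hT => by simpa using hS T (hT.trans hSA))
      (by simpa using heq)
    have h1 : HasPM G (S.biUnion (star G (FactorCritical G) (A \ S) f)) := by
      refine biUnion_induction HasPM.empty (fun A B => HasPM.union)
        (fun a ha b hb hab => disjoint_star ha hb hab) fun s hs => ?_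
      obtain ⟨K, hK⟩ := Finset.card_eq_one.1 (hfc s hs)
      have hKm : K ∈ comps G (FactorCritical G) (A \ S) ∧ f K = s := by
        exact Finset.mem_filter.1 (hK ▸ Finset.mem_singleton_self K)
      obtain ⟨v, hv, hsv⟩ := (hf K hKm.1).2
      rw [hKm.2] at hsv
      rw [star, hK, Finset.singleton_biUnion]
      have hK' := mem_comps.1 hKm.1
      exact hasPM_insert (fun h => (Finset.mem_sdiff.1 (hK'.1.1.1 h)).2 hs) hv hsv hK'.2
    rw [biUnion_star fun K hK => (hf K hK).1] at h1
    have hcl := (closed_compUnion (G := G) (p := FactorCritical G) (A := A \ S))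
    have h2 : HasPM G ((A \ S) \ compUnion G (FactorCritical G) (A \ S)) := by
      refine sub _ ?_ fun X hX => ?_
      · refine Finset.ssubset_iff_subset_ne.2 ⟨by grind, fun h => ?_⟩
        obtain ⟨s, hs⟩ := hSne
        have := hSA hs
        rw [← h] at this
        grind
      · have h3 := cnt_sdiff_of_cnt_eq_zero hcl.sdiff cnt_sdiff_compUnion hX
        have h4 := hS (S ∪ X) (by grind)
        rw [show A \ (S ∪ X) = (A \ S) \ X by grind, h3] at h4
        have := Finset.card_union_le S X
        omega
    have h3 := h1.union (by rw [Finset.disjoint_left]; grind) h2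
    convert h3 using 1
    have := hcl.1
    grind
  have hnfc : ¬ FactorCritical G A := by
    intro h
    have h1 := hS ∅ (by simp)
    have h2 := one_le_cnt hconn h
    simp at h1
    omega
  unfold FactorCritical at hnfc
  push Not at hnfc
  obtain ⟨v, hv, hnpm⟩ := hnfc
  -- Adding `v` to a violator `X` of `A.erase v` gives a set of size |X| + 1 leaving at least |X| +
  -- 1 factor-critical components, against `slack`.
  obtain ⟨X, hX, hlt⟩ := (ih _ (Finset.erase_ssubset hv)).resolve_left hnpm
  have hvX : v ∉ X := fun h => by simpa using hX h
  have h1 := slack (insert v X) (by grind) (by simp)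
  rw [Finset.card_insert_of_notMem hvX] at h1
  have : A \ insert v X = A.erase v \ X := by grind
  rw [this] at h1
  omega

end PathFactor

/-! ### Path covers, coronas and suns -/

namespace PathFactor

variable {V : Type*}

/-- `l` lists the vertices of a path of `G` in order. -/
def IsPathList (G : SimpleGraph V) (l : List V) : Prop :=
  l.IsChain G.Adj ∧ l.Nodup

variable {G G' : SimpleGraph V}

theorem IsPathList.cons {a b : V} {l : List V} (hab : G.Adj a b) (ha : a ∉ b :: l)
    (hl : IsPathList G (b :: l)) : IsPathList G (a :: b :: l) :=
  ⟨List.isChain_cons_cons.2 ⟨hab, hl.1⟩, List.nodup_cons.2 ⟨ha, hl.2⟩⟩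

theorem IsPathList.singleton (a : V) : IsPathList G [a] :=
  ⟨List.isChain_singleton a, List.nodup_singleton a⟩

theorem IsPathList.join {a b : V} {p q : List V} (hp : IsPathList G (a :: p))
    (hq : IsPathList G (b :: q)) (hab : G.Adj a b) (hd : ∀ v ∈ a :: p, v ∉ b :: q) :
    IsPathList G ((a :: p).reverse ++ b :: q) := by
  constructor
  · rw [List.isChain_append]
    refine ⟨?_, hq.1, ?_⟩
    · rw [List.isChain_reverse]
      exact hp.1.imp fun _ _ h => h.symm
    · intro x hx y hy
      simp at hx hy
      subst hx hy
      exact hab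
  · rw [List.nodup_append']
    refine ⟨List.nodup_reverse.2 hp.2, hq.2, ?_⟩
    intro v hv
    exact hd v (List.mem_reverse.1 hv)

/-- `f` attaches to each vertex of `H` a private neighbour outside `H`. -/
structure IsPendantMap (G : SimpleGraph V) (H : Finset V) (f : V → V) : Prop where
  inj : ∀ a ∈ H, ∀ b ∈ H, f a = f b → a = b
  notMem : ∀ a ∈ H, f a ∉ H
  adj : ∀ a ∈ H, G.Adj a (f a)

variable {H : Finset V} {f : V → V}

theorem IsPendantMap.subset (h : IsPendantMap G H f) {B : Finset V} (hB : B ⊆ H) :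
    IsPendantMap G B f :=
  ⟨fun a ha b hb => h.inj a (hB ha) b (hB hb), fun a ha ha' => h.notMem a (hB ha) (hB ha'),
    fun a ha => h.adj a (hB ha)⟩

theorem IsPendantMap.ne (h : IsPendantMap G H f) {a b : V} (ha : a ∈ H) (hb : b ∈ H) :
    f a ≠ b := fun hab => h.notMem a ha (hab ▸ hb)

theorem IsPendantMap.apply_ne (h : IsPendantMap G H f) {a b : V} (ha : a ∈ H) (hb : b ∈ H)
    (hab : a ≠ b) : f a ≠ f b := fun h' => hab (h.inj a ha b hb h')

variable [DecidableEq V]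

/-- The vertex set can be partitioned into vertex sets of paths of `G` with at least three
vertices. -/
inductive PathCover (G : SimpleGraph V) : Finset V → Prop
  | empty : PathCover G ∅
  | cons {A : Finset V} (l : List V) (hl : IsPathList G l) (h3 : 3 ≤ l.length)
      (hd : Disjoint l.toFinset A) (hA : PathCover G A) : PathCover G (l.toFinset ∪ A)

variable {A B C S : Finset V}

theorem PathCover.mono (h : G' ≤ G) (hA : PathCover G' A) : PathCover G A := by
  induction hA with
  | empty => exact PathCover.empty
  | cons l hl h3 hd _ ih => exact PathCover.cons l ⟨hl.1.imp fun _ _ hab => h hab, hl.2⟩ h3 hd ih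

theorem PathCover.union (hAB : Disjoint A B) (hA : PathCover G A) (hB : PathCover G B) :
    PathCover G (A ∪ B) := by
  induction hA with
  | empty => simpa using hB
  | cons l hl h3 hd _ ih =>
    rw [Finset.disjoint_union_left] at hAB
    rw [Finset.union_assoc]
    exact PathCover.cons l hl h3 (Finset.disjoint_union_right.2 ⟨hd, hAB.1⟩) (ih hAB.2)

/-- A path on part of the vertices completes a cover of the remaining ones. -/
theorem PathCover.of_path {l : List V} (hl : IsPathList G l) (h3 : 3 ≤ l.length)
    (hlA : l.toFinset ⊆ A) (hA : PathCover G (A \ l.toFinset)) : PathCover G A := by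
  have := PathCover.cons l hl h3 Finset.disjoint_sdiff hA
  rwa [Finset.union_sdiff_of_subset hlA] at this

/-- `H` together with the vertices `f h`, `h ∈ H`. -/
def thicken (f : V → V) (H : Finset V) : Finset V := H ∪ H.image f

/-- `G[C]` is a factor-critical graph `G[H]` with the pendant vertices `f h`, `h ∈ H`. -/
structure IsCorona (G : SimpleGraph V) (C H : Finset V) (f : V → V) : Prop where
  eq : C = thicken f H
  nonempty : H.Nonempty
  inj : ∀ a ∈ H, ∀ b ∈ H, f a = f b → a = b
  notMem : ∀ a ∈ H, f a ∉ H
  adj_iff : ∀ a ∈ H, ∀ w ∈ C, G.Adj (f a) w ↔ w = a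
  crit : FactorCritical G H

/-- `G[C]` is a sun. -/
def Sun (G : SimpleGraph V) (C : Finset V) : Prop :=
  (∃ v, C = {v}) ∨ ∃ H f, IsCorona G C H f

variable {D : Finset V}

theorem mem_thicken {v : V} : v ∈ thicken f H ↔ v ∈ H ∨ ∃ a ∈ H, f a = v := by
  simp [thicken]

theorem thicken_mono (h : D ⊆ H) : thicken f D ⊆ thicken f H :=
  Finset.union_subset_union h (Finset.image_subset_image h)

theorem thicken_pair {a b : V} : thicken f {a, b} = [f a, a, b, f b].toFinset := by
  ext v
  simp [mem_thicken]
  grind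

theorem thicken_singleton {a : V} : thicken f {a} = {a, f a} := by
  ext v
  simp [mem_thicken, eq_comm]

theorem IsCorona.isPendantMap (h : IsCorona G C H f) : IsPendantMap G H f :=
  ⟨h.inj, h.notMem, fun a ha => ((h.adj_iff a ha a (by rw [h.eq]; simp [thicken, ha])).2 rfl).symm⟩

theorem IsPendantMap.thicken_sdiff (h : IsPendantMap G H f) (hD : D ⊆ H) :
    thicken f H \ thicken f D = thicken f (H \ D) := by
  ext v
  simp only [Finset.mem_sdiff, mem_thicken]
  constructor
  · rintro ⟨hv | ⟨a, ha, rfl⟩, hv'⟩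
    · exact Or.inl ⟨hv, fun h => hv' (Or.inl h)⟩
    · exact Or.inr ⟨a, ⟨ha, fun h => hv' (Or.inr ⟨a, h, rfl⟩)⟩, rfl⟩
  · rintro (⟨hv, hvD⟩ | ⟨a, ⟨ha, haD⟩, rfl⟩)
    · refine ⟨Or.inl hv, ?_⟩
      rintro (h' | ⟨b, hb, rfl⟩)
      · exact hvD h'
      · exact h.notMem b (hD hb) hv
    · refine ⟨Or.inr ⟨a, ha, rfl⟩, ?_⟩
      rintro (h' | ⟨b, hb, hab⟩)
      · exact h.notMem a ha (hD h')
      · exact haD (h.inj b (hD hb) a ha hab ▸ hb)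

theorem IsPendantMap.isPathList (h : IsPendantMap G H f) {a b : V} (ha : a ∈ H) (hb : b ∈ H)
    (hab : G.Adj a b) : IsPathList G [f a, a, b, f b] := by
  have h1 := h.adj a ha
  have h2 := h.adj b hb
  have h3 := h.ne ha ha
  have h4 := h.ne ha hb
  have h5 := h.ne hb ha
  have h6 := h.ne hb hb
  have h7 := h.apply_ne ha hb hab.ne
  have h8 := hab.ne
  exact ⟨by simp [h1.symm, h2, hab], by clear h; grind⟩

/-- Each matching edge `ab` extends by the two pendant vertices to the path `f a, a, b, f b`. -/
theorem IsPendantMap.pathCover (h : IsPendantMap G H f) (hm : HasPM G H) :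
    PathCover G (thicken f H) := by
  induction H using Finset.strongInduction with
  | H H ih =>
  rcases H.eq_empty_or_nonempty with rfl | ⟨a, ha⟩
  · simpa [thicken] using PathCover.empty
  obtain ⟨m, hm⟩ := hm
  obtain ⟨hma, -, hadj⟩ := hm a ha
  have hD : {a, m a} ⊆ H := by simp [Finset.insert_subset_iff, ha, hma]
  have hB : H \ {a, m a} ⊂ H := Finset.sdiff_ssubset hD ⟨a, by simp⟩
  have h1 := ih _ hB (h.subset hB.1) (sdiff_pair_of_matching hm ha)
  rw [← h.thicken_sdiff hD] at h1
  have h2 := thicken_mono (f := f) hD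
  rw [thicken_pair] at h1 h2
  exact PathCover.of_path (h.isPathList ha hma hadj) (by simp) h2 h1

theorem IsCorona.pathCover_sdiff (h : IsCorona G C H f) {a : V} (ha : a ∈ H) :
    PathCover G (C \ {a, f a}) := by
  have h1 := h.isPendantMap
  rw [h.eq, ← thicken_singleton, h1.thicken_sdiff (by simpa), Finset.sdiff_singleton_eq_erase]
  exact (h1.subset (Finset.erase_subset _ _)).pathCover (h.crit a ha)

/-- A sun has, from any of its vertices, a path with at most two vertices which leaves a graph with
a path cover. -/
theorem Sun.exists_tail (h : Sun G C) {w : V} (hw : w ∈ C) :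
    ∃ t : List V, IsPathList G (w :: t) ∧ (w :: t).toFinset ⊆ C ∧ (2 ≤ C.card → t ≠ []) ∧
      PathCover G (C \ (w :: t).toFinset) := by
  rcases h with ⟨v, rfl⟩ | ⟨H, f, h⟩
  · obtain rfl := Finset.mem_singleton.1 hw
    exact ⟨[], IsPathList.singleton w, by simp, by simp, by simpa using PathCover.empty⟩
  · have hp := h.isPendantMap
    have key : ∀ a ∈ H, a ∈ C ∧ f a ∈ C := fun a ha => by
      rw [h.eq, mem_thicken, mem_thicken]
      exact ⟨Or.inl ha, Or.inr ⟨a, ha, rfl⟩⟩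
    rw [h.eq, mem_thicken] at hw
    rcases hw with hw | ⟨a, ha, rfl⟩
    · refine ⟨[f w], (IsPathList.singleton _).cons (hp.adj w hw) ?_, ?_, by simp, ?_⟩
      · simpa using (hp.ne hw hw).symm
      · simp [Finset.insert_subset_iff, key w hw]
      · simpa using h.pathCover_sdiff hw
    · refine ⟨[a], (IsPathList.singleton _).cons (hp.adj a ha).symm ?_, ?_, by simp, ?_⟩
      · simpa using hp.ne ha ha
      · simp [Finset.insert_subset_iff, key a ha]
      · simpa [Finset.pair_comm] using h.pathCover_sdiff ha

/-- From a vertex `w` and a pendant vertex `f a` not paired with it, a corona has disjoint paths with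
two and four vertices which leave a graph with a path cover. -/
theorem IsCorona.exists_two_tails (h : IsCorona G C H f) {a w : V} (ha : a ∈ H) (hw : w ∈ C)
    (hwa : w ≠ a) (hwf : w ≠ f a) :
    ∃ w' d, IsPathList G [w, w'] ∧ IsPathList G [f a, a, d, f d] ∧ w' ∈ C ∧ d ∈ C ∧ f d ∈ C ∧
      (∀ v ∈ [w, w'], v ∉ [f a, a, d, f d]) ∧
      PathCover G (C \ ([w, w'] ++ [f a, a, d, f d]).toFinset) := by
  have hp := h.isPendantMap
  have key : ∀ a ∈ H, a ∈ C ∧ f a ∈ C := fun a ha => by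
    rw [h.eq, mem_thicken, mem_thicken]
    exact ⟨Or.inl ha, Or.inr ⟨a, ha, rfl⟩⟩
  -- `w` belongs to the pair of some core vertex `g`; its partner `w'` completes the path of order
  -- 2.
  obtain ⟨g, w', hg, hww⟩ : ∃ g w', g ∈ H ∧ (w = g ∧ w' = f g ∨ w = f g ∧ w' = g) := by
    rw [h.eq, mem_thicken] at hw
    rcases hw with hw | ⟨g, hg, rfl⟩
    · exact ⟨w, f w, hw, Or.inl ⟨rfl, rfl⟩⟩
    · exact ⟨g, g, hg, Or.inr ⟨rfl, rfl⟩⟩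
  have hga : g ≠ a := by
    rintro rfl
    rcases hww with ⟨rfl, rfl⟩ | ⟨rfl, rfl⟩
    · exact hwa rfl
    · exact hwf rfl
  -- The matching of `H - g` pairs `a` with some `d`, giving the path `f a, a, d, f d`; its other
  -- edges give the cover of the rest.
  obtain ⟨m, hm⟩ := h.crit g hg
  have hag : a ∈ H.erase g := Finset.mem_erase.2 ⟨hga.symm, ha⟩
  obtain ⟨hd, -, had⟩ := hm a hag
  have hpm := sdiff_pair_of_matching hm hag
  generalize m a = d at *
  have hdH := Finset.mem_of_mem_erase hd
  have hdg := Finset.ne_of_mem_erase hd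
  have hsub : {g, a, d} ⊆ H := by simp [Finset.insert_subset_iff, hg, ha, hdH]
  have hset : H.erase g \ {a, d} = H \ {g, a, d} := by
    ext v; simp; tauto
  rw [hset] at hpm
  have hcov := (hp.subset Finset.sdiff_subset).pathCover hpm
  rw [← hp.thicken_sdiff hsub, ← h.eq] at hcov
  have hthick : thicken f {g, a, d} = ([w, w'] ++ [f a, a, d, f d]).toFinset := by
    ext v
    simp [mem_thicken]
    grind
  rw [hthick] at hcov
  have h1 := hp.ne hg ha
  have h2 := hp.ne hg hdH
  have h3 := hp.ne hg hg
  have h4 := hp.ne ha hg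
  have h5 := hp.ne hdH hg
  have h6 := hp.apply_ne hg ha hga
  have h7 := hp.apply_ne hg hdH hdg.symm
  have h8 := hp.adj g hg
  refine ⟨w', d, ?_, hp.isPathList ha hdH had, ?_, (key d hdH).1, (key d hdH).2, ?_, hcov⟩
  · rcases hww with ⟨rfl, rfl⟩ | ⟨rfl, rfl⟩
    · exact (IsPathList.singleton _).cons h8 (by simpa using h3.symm)
    · exact (IsPathList.singleton _).cons h8.symm (by simpa using h3)
  · rcases hww with ⟨rfl, rfl⟩ | ⟨rfl, rfl⟩
    exacts [(key _ hg).2, (key _ hg).1]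
  · rcases hww with ⟨rfl, rfl⟩ | ⟨rfl, rfl⟩ <;> simp [*, hdg.symm] <;> grind

end PathFactor

/-! ### Absorbing a sun into two outer paths -/

namespace PathFactor

variable {V : Type*} [DecidableEq V] {G : SimpleGraph V} {A B C S H : Finset V} {f : V → V}

/-- A corona with at least two core vertices and one pendant vertex removed has a path cover. -/
theorem IsCorona.pathCover_erase (h : IsCorona G C H f) {a : V} (ha : a ∈ H) (hH : H ≠ {a}) :
    PathCover G (C.erase (f a)) := by
  have hp := h.isPendantMap
  obtain ⟨g, hg, hga⟩ : ∃ g ∈ H, g ≠ a := by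
    by_contra! hcon
    exact hH (Finset.eq_singleton_iff_unique_mem.2 ⟨ha, hcon⟩)
  obtain ⟨d, hd, had⟩ : ∃ d ∈ H, G.Adj a d := by
    obtain ⟨m, hm⟩ := h.crit g hg
    have := hm a (Finset.mem_erase.2 ⟨hga.symm, ha⟩)
    exact ⟨m a, Finset.mem_of_mem_erase this.1, this.2.2⟩
  -- The matching of `H - d` pairs `a` with some `e`. The path `f d, d, a, e, f e` then uses both
  -- neighbours `d`, `e` of `a` and omits just `f a`.
  obtain ⟨m, hm⟩ := h.crit d hd
  have hda := had.ne
  have hae : a ∈ H.erase d := Finset.mem_erase.2 ⟨had.ne, ha⟩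
  obtain ⟨he, -, hade⟩ := hm a hae
  have hpm := sdiff_pair_of_matching hm hae
  generalize m a = e at *
  have heH := Finset.mem_of_mem_erase he
  have hed := Finset.ne_of_mem_erase he
  have hsub : {d, a, e} ⊆ H := by simp [Finset.insert_subset_iff, hd, ha, heH]
  have hset : H.erase d \ {a, e} = H \ {d, a, e} := by
    ext v; simp; tauto
  rw [hset] at hpm
  have hcov := (hp.subset Finset.sdiff_subset).pathCover hpm
  rw [← hp.thicken_sdiff hsub, ← h.eq] at hcov
  have hin := thicken_mono (f := f) hsub
  rw [← h.eq] at hin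
  have hthick : thicken f {d, a, e} = insert (f a) [f d, d, a, e, f e].toFinset := by
    ext v
    simp [mem_thicken]
    grind
  rw [hthick] at hcov hin
  have h1 := hp.ne ha ha
  have h2 := hp.ne ha hd
  have h3 := hp.ne ha heH
  have h4 := hp.apply_ne ha hd hda
  have h5 := hp.apply_ne ha heH hade.ne
  have h6 := hp.ne heH hd
  have h7 := hp.apply_ne hd heH hed.symm
  have hpath : IsPathList G [f d, d, a, e, f e] := by
    have h8 := hp.isPathList hd ha had.symm
    have h9 := hp.isPathList ha heH hade
    obtain ⟨h81, h82⟩ := h8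
    obtain ⟨h91, h92⟩ := h9
    have h10 := hp.ne hd heH
    constructor
    · simp at h81 h91 ⊢
      tauto
    · clear h hp
      grind
  refine PathCover.of_path hpath (by simp) ?_ ?_
  · intro v hv
    refine Finset.mem_erase.2 ⟨?_, hin (Finset.mem_insert_of_mem hv)⟩
    rintro rfl
    clear h hp
    simp at hv
    grind
  · convert hcov using 1
    ext v
    simp only [Finset.mem_sdiff, Finset.mem_erase, Finset.mem_insert]
    tauto

/-- The vertices of `C`, of a path attached to `x` and of a nontrivial path that starts in `s` can
always be covered by paths. -/
def Attaches (G : SimpleGraph V) (C : Finset V) (x s : V) : Prop :=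
  ∀ y p q, G.Adj x y → IsPathList G (y :: p) → IsPathList G (s :: q) → q ≠ [] →
    (∀ v ∈ y :: p, v ∉ s :: q) → (∀ v ∈ y :: p, v ∉ C) → (∀ v ∈ s :: q, v ∉ C) →
    PathCover G ((y :: p).toFinset ∪ (s :: q).toFinset ∪ C)

/-- The vertex `x` links the two given paths into a single one, through `y, x, s`. -/
theorem attaches_of_adj {x s : V} (hx : x ∈ C) (hxs : G.Adj x s) (hcov : PathCover G (C.erase x)) :
    Attaches G C x s := by
  intro y p q hxy hyp hsq hq hd1 hd2 hd3
  have h1 := hyp.join (hsq.cons hxs fun h => hd3 x h hx) hxy.symm (by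
    intro v hv hv'
    rcases List.mem_cons.1 hv' with rfl | hv'
    · exact hd2 _ hv hx
    · exact hd1 v hv hv')
  have h2 := PathCover.cons _ h1 (by simp; omega) (by
    rw [Finset.disjoint_left]
    intro v hv hv'
    have := Finset.mem_erase.1 hv'
    simp only [List.mem_toFinset, List.mem_append, List.mem_reverse, List.mem_cons] at hv
    have := hd2 v
    have := hd3 v
    simp only [List.mem_cons] at *
    tauto) hcov
  convert h2 using 1
  ext v
  simp only [List.mem_toFinset, List.mem_append, List.mem_reverse, List.mem_cons,
    Finset.mem_union, Finset.mem_erase]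
  by_cases hvx : v = x <;> simp [hvx, hx]

theorem attaches_of_adj_adj {x x' s : V} (hx : x ∈ C) (hx' : x' ∈ C) (hxx' : G.Adj x x')
    (hxs : G.Adj x' s) (hcov : PathCover G (C \ {x, x'})) : Attaches G C x s := by
  intro y p q hxy hyp hsq hq hd1 hd2 hd3
  have h1 := hyp.join ((hsq.cons hxs fun h => hd3 x' h hx').cons hxx' (by
    intro h
    rcases List.mem_cons.1 h with h | h
    · exact hxx'.ne h
    · exact hd3 x h hx)) hxy.symm (by
    intro v hv hv'
    rcases List.mem_cons.1 hv' with rfl | hv'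
    · exact hd2 _ hv hx
    rcases List.mem_cons.1 hv' with rfl | hv'
    · exact hd2 _ hv hx'
    · exact hd1 v hv hv')
  have h2 := PathCover.cons _ h1 (by simp; omega) (by
    rw [Finset.disjoint_left]
    intro v hv hv'
    simp only [List.mem_toFinset, List.mem_append, List.mem_reverse, List.mem_cons,
      Finset.mem_sdiff, Finset.mem_insert, Finset.mem_singleton] at hv hv'
    have := hd2 v
    have := hd3 v
    simp only [List.mem_cons] at *
    tauto) hcov
  convert h2 using 1
  ext v
  simp only [List.mem_toFinset, List.mem_append, List.mem_reverse, List.mem_cons,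
    Finset.mem_union, Finset.mem_sdiff, Finset.mem_insert, Finset.mem_singleton]
  by_cases hvx : v = x
  · simp [hvx, hx]
  by_cases hvx' : v = x'
  · simp [hvx', hx']
  simp [hvx, hvx']

/-- The outer paths are extended separately, one from `y` along `x :: l`, the other from `s` along
`w :: m`. -/
theorem attaches_of_two_paths {x w s : V} {l m : List V} (hws : G.Adj w s)
    (hl : IsPathList G (x :: l)) (hm : IsPathList G (w :: m)) (hlC : ∀ v ∈ x :: l, v ∈ C)
    (hmC : ∀ v ∈ w :: m, v ∈ C) (hd : ∀ v ∈ w :: m, v ∉ x :: l) (h2 : 2 ≤ l.length)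
    (hcov : PathCover G (C \ (w :: m ++ x :: l).toFinset)) : Attaches G C x s := by
  intro y p q hxy hyp hsq hq hd1 hd2 hd3
  have h1 := hyp.join hl hxy.symm fun v hv hv' => hd2 v hv (hlC v hv')
  have h2 := hsq.join hm hws.symm fun v hv hv' => hd3 v hv (hmC v hv')
  -- The second path needs a vertex of `q` besides `s` and `w` to reach order 3.
  have hq' := List.length_pos_of_ne_nil hq
  have h3 := PathCover.cons _ h2 (by simp; omega) (by
    rw [Finset.disjoint_left]
    intro v hv hv'
    simp only [List.mem_toFinset, List.mem_append, List.mem_reverse, Finset.mem_sdiff,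
      not_or] at hv hv'
    exact hv.elim (fun h => hd3 v h hv'.1) hv'.2.1) hcov
  have h4 := PathCover.cons _ h1 (by simp; omega) (by
    rw [Finset.disjoint_left]
    intro v hv hv'
    simp only [List.mem_toFinset, List.mem_append, List.mem_reverse, Finset.mem_sdiff,
      Finset.mem_union, not_or] at hv hv'
    rcases hv with hv | hv
    · rcases hv' with (hv' | hv') | hv'
      · exact hd1 v hv hv'
      · exact hd2 v hv (hmC v hv')
      · exact hd2 v hv hv'.1
    · rcases hv' with (hv' | hv') | hv'
      · exact hd3 v hv' (hlC v hv)
      · exact hd v hv' hv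
      · exact hv'.2.2 hv) h3
  convert h4 using 1
  ext v
  have hin := hlC v
  have hin' := hmC v
  simp only [List.mem_toFinset, List.mem_append, List.mem_reverse, Finset.mem_sdiff,
    Finset.mem_union]
  generalize (v ∈ y :: p) = P1 at *
  generalize (v ∈ s :: q) = P2 at *
  generalize (v ∈ x :: l) = P3 at *
  generalize (v ∈ w :: m) = P4 at *
  clear * - hin hin'
  tauto

theorem IsCorona.attaches (h : IsCorona G C H f) {a w s : V} (ha : a ∈ H) (hw : w ∈ C)
    (hwa : w ≠ a) (hwf : w ≠ f a) (hws : G.Adj w s) : Attaches G C (f a) s := by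
  obtain ⟨w', d, hww, had, hw', hd, hfd, hdisj, hc⟩ := h.exists_two_tails ha hw hwa hwf
  have haC : a ∈ C ∧ f a ∈ C := by
    rw [h.eq, mem_thicken, mem_thicken]
    exact ⟨Or.inl ha, Or.inr ⟨a, ha, rfl⟩⟩
  exact attaches_of_two_paths hws had hww (by simp [haC, hd, hfd]) (by simp [hw, hw']) hdisj
    (by simp) hc

/-- A sun `C` attached to `S` in such a way that no vertex of `C` has `x` as its only neighbour in
`C ∪ S` attaches to a path at `x` and a path from `S`. -/
theorem Sun.exists_attaches (h : Sun G C) {x : V} (hx : x ∈ C)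
    (hleaf : ∀ z ∈ C, (∀ u ∈ C, G.Adj z u ↔ u = x) → ∃ s ∈ S, G.Adj z s)
    (hS : ∃ w ∈ C, ∃ s ∈ S, G.Adj w s) : ∃ s ∈ S, Attaches G C x s := by
  rcases h with ⟨v, rfl⟩ | ⟨H, f, h⟩
  · obtain rfl := Finset.mem_singleton.1 hx
    obtain ⟨w, hw, s, hs, hws⟩ := hS
    obtain rfl := Finset.mem_singleton.1 hw
    exact ⟨s, hs, attaches_of_adj hx hws (by simpa using PathCover.empty)⟩
  have hp := h.isPendantMap
  have key : ∀ a ∈ H, a ∈ C ∧ f a ∈ C := fun a ha => by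
    rw [h.eq, mem_thicken, mem_thicken]
    exact ⟨Or.inl ha, Or.inr ⟨a, ha, rfl⟩⟩
  have hx0 := hx
  rw [h.eq, mem_thicken] at hx
  rcases hx with hx | ⟨a, ha, rfl⟩
  -- For a core vertex `x`, the pendant vertex `f x` sees only `x` inside `C`, hence some `s ∈ S`;
  -- the path runs through `x, f x, s`.
  · obtain ⟨s, hs, hxs⟩ := hleaf (f x) (key x hx).2 (h.adj_iff x hx)
    exact ⟨s, hs, attaches_of_adj_adj hx0 (key x hx).2 (hp.adj x hx) hxs (h.pathCover_sdiff hx)⟩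
  have hcov : PathCover G (C \ {f a, a}) := by
    rw [Finset.pair_comm]
    exact h.pathCover_sdiff ha
  by_cases hH : H = {a}
  · obtain ⟨s, hs, has⟩ := hleaf a (key a ha).1 (by
      intro u hu
      rw [h.eq, hH, thicken_singleton] at hu
      simp only [Finset.mem_insert, Finset.mem_singleton] at hu
      rcases hu with rfl | rfl
      · simpa using (hp.ne ha ha).symm
      · simpa using hp.adj a ha)
    exact ⟨s, hs, attaches_of_adj_adj hx0 (key a ha).1 (hp.adj a ha).symm has hcov⟩
  -- With at least two core vertices, any contact `w` with `S` serves: `w = a` gives a path through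
  -- `f a, a, s`, `w = f a` a path through `f a, s`, and any other `w` starts a path of its own.
  obtain ⟨w, hw, s, hs, hws⟩ := hS
  refine ⟨s, hs, ?_⟩
  by_cases hwa : w = a
  · subst hwa
    exact attaches_of_adj_adj hx0 hw (hp.adj w ha).symm hws hcov
  by_cases hwf : w = f a
  · subst hwf
    exact attaches_of_adj hx0 hws (h.pathCover_erase ha hH)
  exact h.attaches ha hw hwa hwf hws

end PathFactor

/-! ### Kaneko's condition and reduction at tight or nearly tight sets -/

namespace PathFactor

variable {V : Type*} [DecidableEq V] {G : SimpleGraph V} {A B C S H : Finset V} {f : V → V}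

/-- The number of components of `G[A]` that are suns. -/
noncomputable abbrev sunCnt (G : SimpleGraph V) (A : Finset V) : ℕ := cnt G (Sun G) A

/-- Kaneko's condition for `G[A]`. -/
def SunCond (G : SimpleGraph V) (A : Finset V) : Prop :=
  ∀ S ⊆ A, sunCnt G (A \ S) ≤ 2 * S.card

theorem PathCover.path_union {l : List V} (hl : IsPathList G l) (h3 : 3 ≤ l.length)
    (hA : PathCover G A) (hd : Disjoint l.toFinset A) (hB : B = l.toFinset ∪ A) :
    PathCover G B := hB ▸ PathCover.cons l hl h3 hd hA

/-- Two suns adjacent to a common vertex are covered together with it. -/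
theorem pathCover_insert_suns {K L : Finset V} {s v w : V} (hK : Sun G K) (hL : Sun G L)
    (hKL : Disjoint K L) (hsK : s ∉ K) (hsL : s ∉ L) (hv : v ∈ K) (hw : w ∈ L) (hsv : G.Adj s v)
    (hsw : G.Adj s w) : PathCover G (insert s (K ∪ L)) := by
  obtain ⟨t, ht, htK, -, hcK⟩ := hK.exists_tail hv
  obtain ⟨u, hu, huL, -, hcL⟩ := hL.exists_tail hw
  rw [Finset.disjoint_left] at hKL
  have htK' : ∀ a ∈ v :: t, a ∈ K := fun a ha => htK (List.mem_toFinset.2 ha)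
  have huL' : ∀ a ∈ w :: u, a ∈ L := fun a ha => huL (List.mem_toFinset.2 ha)
  have h1 := ht.join (hu.cons hsw fun h => hsL (huL' s h)) hsv.symm (by
    intro a ha ha'
    rcases List.mem_cons.1 ha' with rfl | ha'
    · exact hsK (htK' a ha)
    · exact hKL (htK' a ha) (huL' a ha'))
  have h2 := PathCover.union (by
    rw [Finset.disjoint_left]
    intro a ha ha'
    exact hKL (Finset.mem_sdiff.1 ha).1 (Finset.mem_sdiff.1 ha').1) hcK hcL
  refine PathCover.path_union h1 (by simp; omega) h2 ?_ ?_
  · rw [Finset.disjoint_left]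
    intro a ha ha'
    have := @hKL a
    have := htK' a
    have := huL' a
    simp only [List.mem_toFinset, List.mem_append, List.mem_reverse, Finset.mem_union,
      Finset.mem_sdiff] at ha ha'
    rw [List.mem_cons (a := a) (b := s)] at ha
    by_cases has : a = s
    · subst has; tauto
    · tauto
  · ext a
    have := htK' a
    have := huL' a
    simp only [List.mem_toFinset, List.mem_append, List.mem_reverse, Finset.mem_union,
      Finset.mem_sdiff, Finset.mem_insert]
    rw [List.mem_cons (a := a) (b := s)]
    tauto

/-- If deleting `S` leaves as many suns as the capacities `c` allow, then the suns are distributed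
among the vertices of `S`, and everything but the stars of vertices of capacity other than two has a
path cover. -/
theorem exists_assignment_pathCover {D T : Finset V} {c : V → ℕ}
    (IH : ∀ B, B ⊂ A → SunCond G B → PathCover G B) (hSA : S ⊆ A) (hSne : S.Nonempty)
    (hhall : ∀ T ⊆ S, sunCnt G (A \ T) ≤ ∑ s ∈ T, c s) (hc : sunCnt G (A \ S) = ∑ s ∈ S, c s)
    (hres : ∀ X ⊆ A \ S, sunCnt G (A \ (S ∪ X)) ≤ sunCnt G (A \ S) + 2 * X.card)
    (hD : Closed G (A \ S) D) (hD0 : sunCnt G D = 0) (hT : T ⊆ S) (hT2 : ∀ s ∈ T, c s = 2) :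
    ∃ f : Finset V → V,
      (∀ K ∈ comps G (Sun G) (A \ S), f K ∈ S ∧ ∃ v ∈ K, G.Adj (f K) v) ∧
      (∀ s ∈ S, ((comps G (Sun G) (A \ S)).filter (f · = s)).card = c s) ∧
      Disjoint D (compUnion G (Sun G) (A \ S)) ∧
      PathCover G (T.biUnion (star G (Sun G) (A \ S) f) ∪
        (((A \ S) \ compUnion G (Sun G) (A \ S)) \ D)) := by
  have : Nonempty V := ⟨hSne.choose⟩
  obtain ⟨f, hf, hfc⟩ := exists_comps_assignment (G := G) hhall hc
  have hDU : Disjoint D (compUnion G (Sun G) (A \ S)) := by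
    rw [Finset.disjoint_left]
    intro v hvD hvU
    obtain ⟨K, hK, hvK⟩ := Finset.mem_biUnion.1 hvU
    have hK' := mem_comps.1 hK
    have hKD := hK'.1.subset_of_mem hD hvK hvD
    exact cnt_eq_zero_iff.1 hD0 K ((hD.isComp_iff hKD).1 hK'.1) hK'.2
  refine ⟨f, hf, hfc, hDU, PathCover.union ?_ ?_ ?_⟩
  · rw [Finset.disjoint_left]
    intro v hv hv'
    have h1 : v ∈ S ∪ compUnion G (Sun G) (A \ S) := by
      rw [← biUnion_star fun K hK => (hf K hK).1]
      exact Finset.biUnion_subset_biUnion_of_subset_left _ hT hv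
    simp only [Finset.mem_sdiff, Finset.mem_union] at h1 hv'
    tauto
  · refine biUnion_induction PathCover.empty (fun A B => PathCover.union)
      (fun a ha b hb hab => disjoint_star (hT ha) (hT hb) hab) fun s hs => ?_
    have hcard := hfc s (hT hs)
    rw [hT2 s hs] at hcard
    obtain ⟨K, L, hKL, hfil⟩ := Finset.card_eq_two.1 hcard
    have hKm : K ∈ comps G (Sun G) (A \ S) ∧ f K = s :=
      Finset.mem_filter.1 (hfil ▸ Finset.mem_insert_self K {L})
    have hLm : L ∈ comps G (Sun G) (A \ S) ∧ f L = s :=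
      Finset.mem_filter.1
        (hfil ▸ Finset.mem_insert_of_mem (Finset.mem_singleton_self L))
    obtain ⟨v, hv, hsv⟩ := (hf K hKm.1).2
    obtain ⟨w, hw, hsw⟩ := (hf L hLm.1).2
    rw [hKm.2] at hsv
    rw [hLm.2] at hsw
    have hK' := mem_comps.1 hKm.1
    have hL' := mem_comps.1 hLm.1
    have := pathCover_insert_suns hK'.2 hL'.2 (hK'.1.disjoint hL'.1 hKL)
      (fun h => (Finset.mem_sdiff.1 (hK'.1.1.1 h)).2 (hT hs))
      (fun h => (Finset.mem_sdiff.1 (hL'.1.1.1 h)).2 (hT hs)) hv hw hsv hsw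
    rw [star, hfil, Finset.biUnion_insert, Finset.singleton_biUnion]
    exact this
  · set N := ((A \ S) \ compUnion G (Sun G) (A \ S)) \ D with hN
    have hNcl : Closed G (A \ S) N := by
      have := (closed_compUnion (G := G) (p := Sun G) (A := A \ S)).sdiff.inter hD.sdiff
      convert this using 1
      ext v
      simp only [hN, Finset.mem_sdiff, Finset.mem_inter]
      tauto
    have hN0 : sunCnt G N = 0 := by
      have h1 := cnt_add_cnt (p := Sun G) (hNcl.mono (B := (A \ S) \ compUnion G (Sun G) (A \ S))
        Finset.sdiff_subset Finset.sdiff_subset)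
      rw [cnt_sdiff_compUnion] at h1
      exact (Nat.add_eq_zero_iff.1 h1.symm).1
    -- Suns of `N \ X` come on top of those of `A \ S`, so `hres` bounds their number by 2|X|.
    refine IH N ?_ fun X hX => ?_
    · refine Finset.ssubset_iff_subset_ne.2 ⟨hNcl.1.trans Finset.sdiff_subset, fun h => ?_⟩
      obtain ⟨s, hs⟩ := hSne
      have h1 := hSA hs
      rw [← h] at h1
      exact (Finset.mem_sdiff.1 (hNcl.1 h1)).2 hs
    · have h1 := cnt_sdiff_of_cnt_eq_zero hNcl hN0 hX
      have h2 := hres X (hX.trans hNcl.1)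
      rw [show A \ (S ∪ X) = (A \ S) \ X by ext; simp; tauto, sunCnt, h1] at h2
      exact Nat.le_of_add_le_add_left h2

/-- A set whose deletion leaves twice as many suns makes a path cover of smaller induced subgraphs
suffice. -/
theorem pathCover_of_tight (IH : ∀ B, B ⊂ A → SunCond G B → PathCover G B) (hA : SunCond G A)
    (hSA : S ⊆ A) (hSne : S.Nonempty) (heq : sunCnt G (A \ S) = 2 * S.card) : PathCover G A := by
  obtain ⟨f, hf, -, -, hcov⟩ := exists_assignment_pathCover (c := fun _ => 2) (D := ∅) (T := S) IH
    hSA hSne (fun T hT => by simpa [mul_comm] using hA T (hT.trans hSA))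
    (by simpa [mul_comm] using heq) (fun X hX => by
      have := hA (S ∪ X) (Finset.union_subset hSA (hX.trans Finset.sdiff_subset))
      have := Finset.card_union_le S X
      omega) ⟨by simp, by simp⟩ (cnt_eq_zero_iff.2 fun C hC => by
      have := hC.1.1
      have := hC.2.1
      simp_all) subset_rfl (by simp)
  rw [biUnion_star fun K hK => (hf K hK).1] at hcov
  convert hcov using 1
  have := (closed_compUnion (G := G) (p := Sun G) (A := A \ S)).1
  ext v
  have := @this v
  have := @hSA v
  simp only [Finset.mem_union, Finset.mem_sdiff, Finset.notMem_empty] at *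
  tauto

/-- If deleting `S` leaves one sun less than twice `|S|`, then, for any `s ∈ S`, everything but `s`
and one sun adjacent to it has a path cover. -/
theorem exists_sun_pathCover_sdiff {D : Finset V} {s : V}
    (IH : ∀ B, B ⊂ A → SunCond G B → PathCover G B) (hA : SunCond G A)
    (hslack : ∀ S ⊆ A, S.Nonempty → sunCnt G (A \ S) < 2 * S.card)
    (hSA : S ⊆ A) (hs : s ∈ S) (heq : sunCnt G (A \ S) + 1 = 2 * S.card)
    (hD : Closed G (A \ S) D) (hD0 : sunCnt G D = 0) :
    ∃ K ∈ comps G (Sun G) (A \ S), (∃ v ∈ K, G.Adj s v) ∧ Disjoint D K ∧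
      PathCover G (A \ (insert s K ∪ D)) := by
  -- With capacity 1 at `s` and 2 elsewhere, a set containing `s` has capacity 2|T| - 1, which is
  -- what `hslack` allows.
  have hsum : ∀ T : Finset V, s ∈ T → ∑ t ∈ T, (if t = s then 1 else 2) + 1 = 2 * T.card := by
    intro T hT
    rw [← Finset.add_sum_erase T _ hT, Finset.sum_congr rfl (g := fun _ => 2)
      (fun t ht => if_neg (Finset.ne_of_mem_erase ht))]
    have := Finset.card_erase_add_one hT
    simp
    omega
  have hsum' : ∀ T : Finset V, s ∉ T → ∑ t ∈ T, (if t = s then 1 else 2) = 2 * T.card := by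
    intro T hT
    rw [Finset.sum_congr rfl (g := fun _ => 2)
      (fun t ht => if_neg (by rintro rfl; exact hT ht))]
    simp [mul_comm]
  obtain ⟨f, hf, hfc, hDU, hcov⟩ := exists_assignment_pathCover
    (c := fun t => if t = s then 1 else 2) (D := D) (T := S.erase s) IH
    hSA ⟨s, hs⟩ (fun T hT => by
      by_cases hsT : s ∈ T
      · have := hsum T hsT
        have := hslack T (hT.trans hSA) ⟨s, hsT⟩
        omega
      · rw [hsum' T hsT]
        exact hA T (hT.trans hSA))
    (by have := hsum S hs; omega) (fun X hX => by
      have := hslack (S ∪ X) (Finset.union_subset hSA (hX.trans Finset.sdiff_subset))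
        ⟨s, by simp [hs]⟩
      have := Finset.card_union_le S X
      omega) hD hD0 (Finset.erase_subset _ _) (fun t ht => if_neg (Finset.ne_of_mem_erase ht))
  have h1 := hfc s hs
  rw [if_pos rfl] at h1
  obtain ⟨K, hK⟩ := Finset.card_eq_one.1 h1
  have hKm : K ∈ comps G (Sun G) (A \ S) ∧ f K = s :=
    Finset.mem_filter.1 (hK ▸ Finset.mem_singleton_self K)
  have hadj := (hf K hKm.1).2
  rw [hKm.2] at hadj
  have hKU : K ⊆ compUnion G (Sun G) (A \ S) := fun v hv => Finset.mem_biUnion.2 ⟨K, hKm.1, hv⟩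
  refine ⟨K, hKm.1, hadj, Finset.disjoint_of_subset_right hKU hDU, ?_⟩
  convert hcov using 1
  have hstar : star G (Sun G) (A \ S) f s = insert s K := by
    rw [star, hK, Finset.singleton_biUnion]; rfl
  have hall : (insert s (S.erase s)).biUnion (star G (Sun G) (A \ S) f) =
      S ∪ compUnion G (Sun G) (A \ S) := by
    rw [Finset.insert_erase hs]
    exact biUnion_star fun K hK => (hf K hK).1
  have hdis : Disjoint (insert s K) ((S.erase s).biUnion (star G (Sun G) (A \ S) f)) := by
    rw [← hstar, Finset.disjoint_biUnion_right]
    intro t ht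
    exact disjoint_star hs (Finset.mem_of_mem_erase ht) (Finset.ne_of_mem_erase ht).symm
  rw [Finset.biUnion_insert, hstar] at hall
  have hUA := (closed_compUnion (G := G) (p := Sun G) (A := A \ S)).1
  have hDA := hD.1
  ext v
  have hall' := Finset.ext_iff.1 hall v
  rw [Finset.disjoint_left] at hdis hDU
  have e1 := @hdis v
  have e2 := @hDU v
  have e3 := @hUA v
  have e4 := @hDA v
  have e5 := @hSA v
  clear hall hdis hDU hUA hDA hSA hcov
  simp only [Finset.mem_union, Finset.mem_sdiff] at *
  generalize (v ∈ insert s K) = P1 at *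
  generalize (v ∈ (S.erase s).biUnion (star G (Sun G) (A \ S) f)) = P2 at *
  generalize (v ∈ compUnion G (Sun G) (A \ S)) = P3 at *
  clear * - hall' e1 e2 e3 e4 e5
  tauto

/-- Without tight sets, deleting `y` leaves at most one sun, so `K` is the sun assigned to `y`. As
`K` has two vertices, `y` followed by a tail in `K` has order 3. -/
theorem pathCover_of_cut_sun {y : V} {K : Finset V}
    (IH : ∀ B, B ⊂ A → SunCond G B → PathCover G B) (hA : SunCond G A)
    (hslack : ∀ S ⊆ A, S.Nonempty → sunCnt G (A \ S) < 2 * S.card) (hy : y ∈ A)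
    (hK : IsComp G (A \ {y}) K) (hKs : Sun G K) (hK2 : 2 ≤ K.card) : PathCover G A := by
  have h1 := hslack {y} (by simpa) (by simp)
  have h2 : 1 ≤ sunCnt G (A \ {y}) := one_le_cnt hK hKs
  simp only [Finset.card_singleton] at h1
  have heq : sunCnt G (A \ {y}) = 1 := by omega
  obtain ⟨L, hL, ⟨v, hv, hyv⟩, -, hcov⟩ := exists_sun_pathCover_sdiff (D := ∅) IH hA hslack
    (S := {y}) (by simpa) (Finset.mem_singleton_self y) (by simp; omega)
    ⟨by simp, by simp⟩ (cnt_eq_zero_iff.2 fun C hC => by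
      have := hC.1.1
      have := hC.2.1
      simp_all)
  obtain rfl : L = K := Finset.card_le_one.1 heq.le L hL K (mem_comps.2 ⟨hK, hKs⟩)
  obtain ⟨t, ht, htK, ht0, hc⟩ := hKs.exists_tail hv
  have hyL : y ∉ L := fun h => by simpa using hK.1.1 h
  have hp := ht.cons hyv fun h => hyL (htK (List.mem_toFinset.2 h))
  have := List.length_pos_of_ne_nil (ht0 hK2)
  have hLA : L ⊆ A := hK.1.1.trans Finset.sdiff_subset
  refine PathCover.path_union hp (by simp; omega) (PathCover.union ?_ hc hcov) ?_ ?_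
  · rw [Finset.disjoint_left]
    intro a ha ha'
    simp only [Finset.mem_sdiff, Finset.mem_union, Finset.mem_insert] at ha ha'
    tauto
  · rw [Finset.disjoint_left]
    intro a ha ha'
    have := @htK a
    rw [List.toFinset_cons, Finset.mem_insert] at ha
    simp only [Finset.mem_sdiff, Finset.mem_union, Finset.mem_insert (b := y)] at ha'
    rcases ha with rfl | ha
    · tauto
    · tauto
  · rw [List.toFinset_cons]
    ext a
    have := @htK a
    have := @hLA a
    simp only [Finset.mem_sdiff, Finset.mem_union, Finset.mem_insert (b := y), Finset.notMem_empty]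
    by_cases hay : a = y
    · simp [hay, hy]
    · tauto

end PathFactor

/-! ### Deleting an edge -/

namespace PathFactor

section Congr

variable {V : Type*} {G G' : SimpleGraph V} {A C : Finset V}

/-- The graph `G` without the edge `xy`. -/
abbrev delEdge (G : SimpleGraph V) (x y : V) : SimpleGraph V := G.deleteEdges {s(x, y)}

theorem delEdge_adj {x y a b : V} :
    (delEdge G x y).Adj a b ↔ G.Adj a b ∧ ¬ (a = x ∧ b = y ∨ a = y ∧ b = x) := by
  simp [delEdge, SimpleGraph.deleteEdges_adj]

theorem delEdge_le {x y : V} : delEdge G x y ≤ G := SimpleGraph.deleteEdges_le _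

theorem delEdge_agree {x y : V} (h : ¬ (x ∈ C ∧ y ∈ C)) :
    ∀ a ∈ C, ∀ b ∈ C, G.Adj a b ↔ (delEdge G x y).Adj a b := by
  intro a ha b hb
  rw [delEdge_adj]
  constructor
  · refine fun hab => ⟨hab, ?_⟩
    rintro (⟨rfl, rfl⟩ | ⟨rfl, rfl⟩)
    exacts [h ⟨ha, hb⟩, h ⟨hb, ha⟩]
  · exact And.left

theorem Closed.of_delEdge {x y : V} (h : Closed (delEdge G x y) A C) (hx : x ∉ C) (hy : y ∉ C) :
    Closed G A C :=
  ⟨h.1, fun a ha b hb hab => h.2 a ha b hb (delEdge_adj.2 ⟨hab, by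
    rintro (⟨rfl, -⟩ | ⟨rfl, -⟩)
    exacts [hx ha, hy ha]⟩)⟩

theorem HasPM.congr (h : ∀ a ∈ A, ∀ b ∈ A, G.Adj a b → G'.Adj a b) (hA : HasPM G A) :
    HasPM G' A := by
  obtain ⟨m, hm⟩ := hA
  exact ⟨m, fun a ha => ⟨(hm a ha).1, (hm a ha).2.1, h a ha _ (hm a ha).1 (hm a ha).2.2⟩⟩

theorem IsComp.congr (h : ∀ a ∈ A, ∀ b ∈ A, G.Adj a b ↔ G'.Adj a b) (hC : IsComp G A C) :
    IsComp G' A C := by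
  have := comps_congr (p := fun _ => True) (p' := fun _ => True) h fun _ _ => Iff.rfl
  have h1 : C ∈ comps G (fun _ => True) A := mem_comps.2 ⟨hC, trivial⟩
  rw [this] at h1
  exact (mem_comps.1 h1).1

theorem Sun.congr [DecidableEq V] (h : ∀ a ∈ C, ∀ b ∈ C, G.Adj a b ↔ G'.Adj a b)
    (hC : Sun G C) : Sun G' C := by
  refine hC.imp id ?_
  rintro ⟨H, f, hH⟩
  have hsub : ∀ a ∈ H, a ∈ C ∧ f a ∈ C := fun a ha => by
    rw [hH.eq, mem_thicken, mem_thicken]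
    exact ⟨Or.inl ha, Or.inr ⟨a, ha, rfl⟩⟩
  refine ⟨H, f, hH.eq, hH.nonempty, hH.inj, hH.notMem, fun a ha w hw => ?_, fun v hv => ?_⟩
  · rw [← h _ (hsub a ha).2 w hw]
    exact hH.adj_iff a ha w hw
  · exact (hH.crit v hv).congr fun a ha b hb hab =>
      (h a (hsub a (Finset.mem_of_mem_erase ha)).1 b (hsub b (Finset.mem_of_mem_erase hb)).1).1 hab

theorem sunCnt_congr [DecidableEq V] (h : ∀ a ∈ A, ∀ b ∈ A, G.Adj a b ↔ G'.Adj a b) :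
    sunCnt G A = sunCnt G' A := by
  unfold sunCnt cnt
  rw [comps_congr h]
  intro C hC
  exact ⟨Sun.congr fun a ha b hb => h a (hC ha) b (hC hb),
    Sun.congr fun a ha b hb => (h a (hC ha) b (hC hb)).symm⟩

end Congr

variable {V : Type*} [DecidableEq V] {G : SimpleGraph V} {A B C S H : Finset V} {f : V → V}

/-- If deleting the edge `xy` creates two more suns, then it joins two suns that form a component
which is not a sun. -/
theorem exists_split_of_delEdge {x y : V} (hxy : G.Adj x y)
    (h : sunCnt G A + 2 ≤ sunCnt (delEdge G x y) A) :
    ∃ C₁ C₂ : Finset V, x ∈ C₁ ∧ y ∈ C₂ ∧ Disjoint C₁ C₂ ∧ IsComp G C₁ C₁ ∧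
      Sun G C₁ ∧ Sun G C₂ ∧ Closed G A (C₁ ∪ C₂) ∧ sunCnt G (C₁ ∪ C₂) = 0 ∧
      (∀ a ∈ C₁, ∀ b ∈ C₂, G.Adj a b → a = x ∧ b = y) ∧
      sunCnt (delEdge G x y) A = sunCnt G A + 2 := by
  by_cases hxyA : ¬ (x ∈ A ∧ y ∈ A)
  · rw [← sunCnt_congr (delEdge_agree hxyA)] at h
    omega
  rw [not_not] at hxyA
  obtain ⟨D, hD, hxD⟩ := exists_isComp (G := G) hxyA.1
  have hyD := hD.1.2 x hxD y hxyA.2 hxy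
  have hD' : Closed (delEdge G x y) A D :=
    ⟨hD.1.1, fun a ha b hb hab => hD.1.2 a ha b hb (delEdge_adj.1 hab).1⟩
  have e1 : sunCnt (delEdge G x y) A = sunCnt (delEdge G x y) D + sunCnt (delEdge G x y) (A \ D) :=
    cnt_add_cnt hD'
  have e2 : sunCnt G A = sunCnt G D + sunCnt G (A \ D) := cnt_add_cnt hD.1
  have e3 := sunCnt_congr (G := G)
    (delEdge_agree (G := G) (C := A \ D) (x := x) (y := y) (by simp [hxD]))
  have hDD := isComp_self_iff.1 hD.isComp_self
  obtain ⟨C₁, hC₁, hx₁⟩ := exists_isComp (G := delEdge G x y) hxD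
  obtain ⟨C₂, hC₂, hy₂⟩ := exists_isComp (G := delEdge G x y) hyD
  -- A component of `D` without the edge that misses both `x` and `y` would be closed in `G`, hence
  -- equal to `D`. So only the components of `x` and `y` remain, and both must be suns for the count
  -- to rise by 2.
  have hsub : comps (delEdge G x y) (Sun (delEdge G x y)) D ⊆ {C₁, C₂} := by
    intro C hC
    have hC' := (mem_comps.1 hC).1
    rw [Finset.mem_insert, Finset.mem_singleton]
    by_cases hxC : x ∈ C
    · exact Or.inl (hC'.eq_of_mem hC₁ hxC hx₁)
    by_cases hyC : y ∈ C
    · exact Or.inr (hC'.eq_of_mem hC₂ hyC hy₂)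
    have := hDD.2 C (hC'.1.of_delEdge hxC hyC) hC'.2.1
    exact absurd (this ▸ hxD) hxC
  have hle : sunCnt (delEdge G x y) D ≤ 2 := (Finset.card_le_card hsub).trans Finset.card_le_two
  have h2 : sunCnt (delEdge G x y) D = 2 := by omega
  have heq := Finset.eq_of_subset_of_card_le hsub (Finset.card_le_two.trans h2.ge)
  have hne : C₁ ≠ C₂ := by
    rintro rfl
    rw [sunCnt, cnt, heq] at h2
    simp at h2
  have hs₁ : Sun (delEdge G x y) C₁ := (mem_comps.1 (heq ▸ Finset.mem_insert_self C₁ {C₂})).2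
  have hs₂ : Sun (delEdge G x y) C₂ :=
    (mem_comps.1 (heq ▸ Finset.mem_insert_of_mem (Finset.mem_singleton_self C₂))).2
  have hdis := hC₁.disjoint hC₂ hne
  have hdis' := Finset.disjoint_left.1 hdis
  have ag₁ := delEdge_agree (G := G) (C := C₁) (x := x) (y := y) fun h => hdis' h.2 hy₂
  have ag₂ := delEdge_agree (G := G) (C := C₂) (x := x) (y := y) fun h => hdis' hx₁ h.1
  have hun : C₁ ∪ C₂ = D := by
    by_contra hcon
    have hcl := (hC₁.1.union hC₂.1).sdiff.of_delEdge (G := G) (by simp [hx₁]) (by simp [hy₂])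
    have := hDD.2 _ hcl (by
      rw [Finset.sdiff_nonempty]
      intro hsub
      exact hcon ((Finset.union_subset hC₁.1.1 hC₂.1.1).antisymm hsub))
    have hx' := this ▸ hxD
    simp [hx₁] at hx'
  refine ⟨C₁, C₂, hx₁, hy₂, hdis,
    hC₁.isComp_self.congr fun a ha b hb => (ag₁ a ha b hb).symm,
    hs₁.congr fun a ha b hb => (ag₁ a ha b hb).symm,
    hs₂.congr fun a ha b hb => (ag₂ a ha b hb).symm, hun ▸ hD.1, by rw [hun]; omega, ?_, by omega⟩
  intro a ha b hb hab
  by_contra hcon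
  refine hdis' (hC₁.1.2 a ha b (hC₂.1.1 hb) (delEdge_adj.2 ⟨hab, ?_⟩)) hb
  rintro (h | ⟨rfl, rfl⟩)
  · exact hcon h
  · exact hdis' ha hy₂

/-- The situation in which no proper subset of `A` can be used to reduce the problem for `G[A]`. -/
structure Reduced (G : SimpleGraph V) (A : Finset V) : Prop where
  ih : ∀ B, B ⊂ A → SunCond G B → PathCover G B
  cond : SunCond G A
  slack : ∀ S ⊆ A, S.Nonempty → sunCnt G (A \ S) < 2 * S.card
  conn : IsComp G A A

variable {x y : V}

/-- Set bookkeeping for the next lemma: `P` and `Q` are the parts of `K` and `C₂` used by the tails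
that are joined to `C₁` and `s`. -/
theorem PathCover.glue {P Q K C₁ C₂ : Finset V} {s : V} (hP : P ⊆ K) (hQ : Q ⊆ C₂) (hKA : K ⊆ A)
    (hCA : C₁ ∪ C₂ ⊆ A) (hsA : s ∈ A) (hCK : Disjoint (C₁ ∪ C₂) K) (hCC : Disjoint C₁ C₂)
    (hsK : s ∉ K) (hsC : s ∉ C₁ ∪ C₂) (h₁ : PathCover G (insert s (Q ∪ P ∪ C₁)))
    (h₂ : PathCover G (K \ P)) (h₃ : PathCover G (C₂ \ Q))
    (h₄ : PathCover G (A \ (insert s K ∪ (C₁ ∪ C₂)))) : PathCover G A := by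
  rw [Finset.disjoint_left] at hCK hCC
  have huni : A = insert s (Q ∪ P ∪ C₁) ∪ (K \ P) ∪ (C₂ \ Q) ∪
      (A \ (insert s K ∪ (C₁ ∪ C₂))) := by
    clear h₁ h₂ h₃ h₄
    ext a
    have e1 := @hP a
    have e2 := @hQ a
    have e3 := @hKA a
    have e4 := @hCA a
    simp only [Finset.mem_union, Finset.mem_sdiff, Finset.mem_insert] at e4 ⊢
    clear hP hQ hKA hCA hCK hCC
    grind
  rw [huni]
  refine PathCover.union ?_ (PathCover.union ?_ (PathCover.union ?_ h₁ h₂) h₃) h₄ <;>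
  · clear h₁ h₂ h₃ h₄ huni
    rw [Finset.disjoint_left]
    intro a ha ha'
    have e1 := @hP a
    have e2 := @hQ a
    have e3 := @hCK a
    have e4 := @hCC a
    simp only [Finset.mem_union, Finset.mem_sdiff, Finset.mem_insert] at ha ha' e3 hsC
    clear hP hQ hKA hCA hCK hCC
    grind

/-- Since `S` is not tight in `G`, the violation forces a gain of exactly two suns `C₁ ∋ x` and `C₂
∋ y`, and sun(A - S) = 2|S| - 1. Either `C₁` is cut off by `y` alone, or it is absorbed between a
path ending in `y` and one ending in some `s ∈ S`. -/
theorem Reduced.pathCover_of_cut (h : Reduced G A)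
    (hyA : y ∈ A) (hxy : G.Adj x y)
    (hx : ¬ ∀ b ∈ A, G.Adj x b ↔ b = y) (hz : ∀ z ∈ A, ¬ ∀ b ∈ A, G.Adj z b ↔ b = x)
    (hSA : S ⊆ A) (hSne : S.Nonempty)
    (hS : 2 * S.card < sunCnt (delEdge G x y) (A \ S)) : PathCover G A := by
  have h0 := h.slack S hSA hSne
  obtain ⟨C₁, C₂, hx₁, hy₂, hdis, hconn, hs₁, hs₂, hcl, hcnt, hbr, heq⟩ :=
    exists_split_of_delEdge (A := A \ S) hxy (by omega)
  have htight : sunCnt G (A \ S) + 1 = 2 * S.card := by omega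
  have hdis' := Finset.disjoint_left.1 hdis
  have hCA : ∀ v ∈ C₁ ∪ C₂, v ∈ A ∧ v ∉ S := fun v hv => Finset.mem_sdiff.1 (hcl.1 hv)
  have hnbr : ∀ a ∈ C₁, ∀ b ∈ A, b ∉ S → G.Adj a b → b ∈ C₁ ∨ (a = x ∧ b = y) := by
    intro a ha b hb hbS hab
    rcases Finset.mem_union.1 (hcl.2 a (Finset.mem_union_left _ ha) b
      (Finset.mem_sdiff.2 ⟨hb, hbS⟩) hab) with h | h
    · exact Or.inl h
    · exact Or.inr (hbr a ha b h hab)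
  by_cases hatt : ∃ w ∈ C₁, ∃ s ∈ S, G.Adj w s
  swap
  · push Not at hatt
    have hcl₁ : Closed G (A \ {y}) C₁ := by
      refine ⟨fun v hv => ?_, fun a ha b hb hab => ?_⟩
      · rw [Finset.mem_sdiff, Finset.mem_singleton]
        refine ⟨(hCA v (Finset.mem_union_left _ hv)).1, ?_⟩
        rintro rfl
        exact hdis' hv hy₂
      · rw [Finset.mem_sdiff, Finset.mem_singleton] at hb
        exact (hnbr a ha b hb.1 (fun hbS => hatt a ha b hbS hab) hab).resolve_right
          fun h => hb.2 h.2
    -- If `C₁` were just `{x}`, then `x` would be a leaf at `y`, against `hx`.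
    by_cases h2 : 2 ≤ C₁.card
    · exact pathCover_of_cut_sun h.ih h.cond h.slack hyA (hconn.of_closed hcl₁) hs₁ h2
    · exfalso
      refine hx fun b hb => ⟨fun hxb => ?_, fun hby => hby ▸ hxy⟩
      rcases hnbr x hx₁ b hb (fun hbS => hatt x hx₁ b hbS hxb) hxb with hb₁ | hb₁
      · have := Finset.card_le_one.1 (by omega) x hx₁ b hb₁
        exact absurd this hxb.ne
      · exact hb₁.2
  -- The only edge from `C₁` to `C₂` starts in `x`, so a vertex seeing only `x` in `C₁` and nothing
  -- in `S` would be a leaf at `x`, against `hz`.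
  obtain ⟨s, hs, hsatt⟩ := hs₁.exists_attaches (S := S) hx₁ (by
    intro z hzC hzx
    by_contra! hcon
    refine hz z (hCA z (Finset.mem_union_left _ hzC)).1 fun b hb => ⟨fun hzb => ?_, ?_⟩
    · rcases hnbr z hzC b hb (fun hbS => hcon b hbS hzb) hzb with hb₁ | hb₁
      · exact (hzx b hb₁).1 hzb
      · exact absurd ((hzx x hx₁).2 rfl) (hb₁.1 ▸ G.irrefl)
    · rintro rfl
      exact (hzx b hx₁).2 rfl) hatt
  obtain ⟨K, hK, ⟨v, hvK, hsv⟩, hDK, hcov⟩ := exists_sun_pathCover_sdiff h.ih h.cond h.slack hSA hs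
    htight hcl hcnt
  have hK' := mem_comps.1 hK
  obtain ⟨t, ht, htK, -, hct⟩ := hK'.2.exists_tail hvK
  obtain ⟨u, hu, huC, -, hcu⟩ := hs₂.exists_tail hy₂
  have htK' : ∀ a ∈ v :: t, a ∈ K := fun a ha => htK (List.mem_toFinset.2 ha)
  have huC' : ∀ a ∈ y :: u, a ∈ C₂ := fun a ha => huC (List.mem_toFinset.2 ha)
  have hKS : ∀ a ∈ K, a ∈ A ∧ a ∉ S := fun a ha => Finset.mem_sdiff.1 (hK'.1.1.1 ha)
  rw [Finset.disjoint_left] at hDK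
  have hsC : s ∉ C₁ ∪ C₂ := fun h' => (hCA s h').2 hs
  have hsK : s ∉ K := fun h' => (hKS s h').2 hs
  -- The outer paths are `y` with a tail in `C₂` and `s` with a tail in its sun `K`.
  have hC₁ := hsatt y u (v :: t) hxy hu (ht.cons hsv fun h' => hsK (htK' s h')) (by simp)
    (by
      intro a ha ha'
      have haC := Finset.mem_union_right C₁ (huC' a ha)
      rcases List.mem_cons.1 ha' with rfl | ha'
      · exact hsC haC
      · exact hDK haC (htK' a ha'))
    (fun a ha ha' => hdis' ha' (huC' a ha))
    (by
      intro a ha ha'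
      have haC := Finset.mem_union_left C₂ ha'
      rcases List.mem_cons.1 ha with rfl | ha
      · exact hsC haC
      · exact hDK haC (htK' a ha))
  have hCC : (y :: u).toFinset ∪ (s :: v :: t).toFinset ∪ C₁ =
      insert s ((y :: u).toFinset ∪ (v :: t).toFinset ∪ C₁) := by
    rw [List.toFinset_cons (a := s)]
    ext a
    simp only [Finset.mem_union, Finset.mem_insert (b := s)]
    tauto
  rw [hCC] at hC₁
  refine PathCover.glue htK huC (fun a ha => (hKS a ha).1) (fun a ha => (hCA a ha).1) (hSA hs)
    (Finset.disjoint_left.2 hDK) hdis hsK hsC hC₁ hct hcu hcov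

/-- Either all of `A` is a sun without the edge `xy`, and restoring the edge yields a path of order
6, or `xy` is a bridge with a sun at one end. -/
theorem Reduced.pathCover_of_sun_delEdge (h : Reduced G A)
    (hxA : x ∈ A) (hyA : y ∈ A) (hxy : G.Adj x y)
    (hx : ¬ ∀ b ∈ A, G.Adj x b ↔ b = y) (hz : ∀ z ∈ A, ¬ ∀ b ∈ A, G.Adj z b ↔ b = x)
    (hS : 0 < sunCnt (delEdge G x y) A) : PathCover G A := by
  obtain ⟨K, hK⟩ := Finset.card_pos.1 hS
  obtain ⟨hK, hKs⟩ := mem_comps.1 hK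
  have hnot : ¬ (delEdge G x y).Adj x y := by simp
  by_cases hKA : K = A
  · subst hKA
    rcases hKs with ⟨v, rfl⟩ | ⟨H, f, hc⟩
    · rw [Finset.mem_singleton] at hxA hyA
      exact absurd (hxA.trans hyA.symm) hxy.ne
    have hp := hc.isPendantMap
    have key : ∀ a ∈ H, a ∈ K ∧ f a ∈ K := fun a ha => by
      rw [hc.eq, mem_thicken, mem_thicken]
      exact ⟨Or.inl ha, Or.inr ⟨a, ha, rfl⟩⟩
    have hx0 := hxA
    rw [hc.eq, mem_thicken] at hxA
    rcases hxA with hxH | ⟨a, ha, rfl⟩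
    · exfalso
      -- For a core vertex `x`, the pendant vertex `f x` remains a leaf at `x` when the edge is
      -- restored.
      refine hz (f x) (key x hxH).2 fun b hb => ⟨fun hab => ?_, ?_⟩
      · by_contra hbx
        refine hbx ((hc.adj_iff x hxH b hb).1 (delEdge_adj.2 ⟨hab, ?_⟩))
        rintro (h' | h')
        · exact hp.ne hxH hxH h'.1
        · exact hbx h'.2
      · rintro rfl
        exact (delEdge_adj.1 (hp.adj b hxH)).1.symm
    · have hya : y ≠ a := by
        rintro rfl
        exact hnot (hp.adj y ha).symm
      -- Here `x = f a` is pendant and `y` lies in another pair, so the edge `xy` joins the path on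
      -- `y, w` to the path on `f a, a, d, f d`.
      obtain ⟨w, d, hyw, hfa, hw, hd, hfd, hdisj, hcov⟩ :=
        hc.exists_two_tails ha hyA hya hxy.ne.symm
      have mono : ∀ l, IsPathList (delEdge G (f a) y) l → IsPathList G l := fun l hl =>
        ⟨hl.1.imp fun _ _ hab => (delEdge_adj.1 hab).1, hl.2⟩
      refine PathCover.path_union ((mono _ hyw).join (mono _ hfa) hxy.symm hdisj) (by simp)
        (hcov.mono delEdge_le) ?_ ?_
      · rw [Finset.disjoint_left]
        intro v hv hv'
        rw [Finset.mem_sdiff] at hv'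
        refine hv'.2 ?_
        simp only [List.mem_toFinset, List.mem_append, List.mem_reverse] at hv ⊢
        exact hv
      · rw [show ([y, w].reverse ++ [f a, a, d, f d]).toFinset =
          ([y, w] ++ [f a, a, d, f d]).toFinset by
            ext v; simp only [List.mem_toFinset, List.mem_append, List.mem_reverse],
          Finset.union_sdiff_of_subset]
        intro v hv
        simp only [List.mem_toFinset, List.mem_append, List.mem_cons, List.not_mem_nil,
          or_false] at hv
        have := key a ha
        rcases hv with (rfl | rfl) | (rfl | rfl | rfl | rfl) <;> tauto
  -- When `K` contains just the end `u` of the edge, it is a sun component of `A - w`; as `u` is not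
  -- a leaf at `w`, it has a second vertex.
  have cut : ∀ u w, u ∈ K → w ∉ K → w ∈ A → G.Adj u w → (u = x ∧ w = y ∨ u = y ∧ w = x) →
      (¬ ∀ b ∈ A, G.Adj u b ↔ b = w) → PathCover G A := by
    intro u w hu hw hwA huw hcase hleaf
    have hcl : Closed G (A \ {w}) K := by
      refine ⟨fun v hv => ?_, fun a ha b hb hab => ?_⟩
      · rw [Finset.mem_sdiff, Finset.mem_singleton]
        refine ⟨hK.1.1 hv, ?_⟩
        rintro rfl
        exact hw hv
      · rw [Finset.mem_sdiff, Finset.mem_singleton] at hb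
        refine hK.1.2 a ha b hb.1 (delEdge_adj.2 ⟨hab, ?_⟩)
        have haw : a ≠ w := by rintro rfl; exact hw ha
        rcases hcase with ⟨rfl, rfl⟩ | ⟨rfl, rfl⟩ <;> tauto
    have hag := delEdge_agree (G := G) (C := K) (x := x) (y := y) (by
      rcases hcase with ⟨rfl, rfl⟩ | ⟨rfl, rfl⟩ <;> tauto)
    have hcomp : IsComp G K K := hK.isComp_self.congr fun a ha b hb => (hag a ha b hb).symm
    refine pathCover_of_cut_sun h.ih h.cond h.slack hwA (hcomp.of_closed hcl)
      (hKs.congr fun a ha b hb => (hag a ha b hb).symm) ?_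
    by_contra hcard
    refine hleaf fun b hb => ⟨fun hub => ?_, fun hbw => hbw ▸ huw⟩
    by_contra hbw
    have hbK := hcl.2 u hu b (by simp [hb, hbw]) hub
    exact hub.ne (Finset.card_le_one.1 (by omega) u hu b hbK)
  by_cases hxK : x ∈ K
  · by_cases hyK : y ∈ K
    · refine absurd ((isComp_self_iff.1 h.conn).2 K ⟨hK.1.1, fun a ha b hb hab => ?_⟩ hK.2.1) hKA
      by_contra hbK
      refine hbK (hK.1.2 a ha b hb (delEdge_adj.2 ⟨hab, ?_⟩))
      rintro (⟨rfl, rfl⟩ | ⟨rfl, rfl⟩)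
      exacts [hbK hyK, hbK hxK]
    · exact cut x y hxK hyK hyA hxy (Or.inl ⟨rfl, rfl⟩) hx
  · by_cases hyK : y ∈ K
    · exact cut y x hyK hxK hxA hxy.symm (Or.inr ⟨rfl, rfl⟩) (hz y hyA)
    · exact absurd ((isComp_self_iff.1 h.conn).2 K (hK.1.of_delEdge hxK hyK) hK.2.1) hKA

end PathFactor

/-! ### Graphs in which every vertex is or carries a leaf, and Kaneko's theorem -/

namespace PathFactor

variable {V : Type*} {G : SimpleGraph V} {A B C S H : Finset V} {f : V → V}

theorem isComp_singleton {v : V} (hv : v ∈ B) (h : ∀ b ∈ B, ¬ G.Adj v b) : IsComp G B {v} := by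
  refine ⟨⟨by simpa, fun a ha b hb hab => ?_⟩, by simp, fun D _ hD hne => ?_⟩
  · rw [Finset.mem_singleton.1 ha] at hab
    exact absurd hab (h b hb)
  · exact hne.subset_singleton_iff.1 hD

open scoped Classical in
/-- The ordered pairs of adjacent vertices of `G[A]`. -/
noncomputable def adjPairs (G : SimpleGraph V) (A : Finset V) : Finset (V × V) :=
  (A ×ˢ A).filter fun e => G.Adj e.1 e.2

theorem mem_adjPairs {e : V × V} : e ∈ adjPairs G A ↔ (e.1 ∈ A ∧ e.2 ∈ A) ∧ G.Adj e.1 e.2 := by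
  simp [adjPairs]

theorem adjPairs_mono (h : B ⊆ A) : adjPairs G B ⊆ adjPairs G A := fun e he => by
  rw [mem_adjPairs] at he ⊢
  exact ⟨⟨h he.1.1, h he.1.2⟩, he.2⟩

theorem adjPairs_delEdge_ssubset {x y : V} (hx : x ∈ A) (hy : y ∈ A) (hxy : G.Adj x y) :
    adjPairs (delEdge G x y) A ⊂ adjPairs G A := by
  refine Finset.ssubset_iff_subset_ne.2 ⟨fun e he => ?_, fun heq => ?_⟩
  · rw [mem_adjPairs] at he ⊢
    exact ⟨he.1, (delEdge_adj.1 he.2).1⟩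
  · have : (x, y) ∈ adjPairs G A := mem_adjPairs.2 ⟨⟨hx, hy⟩, hxy⟩
    rw [← heq, mem_adjPairs] at this
    simp at this

variable [DecidableEq V]

theorem Reduced.not_sun (h : Reduced G A) : ¬ Sun G A := by
  intro hs
  have h1 := h.cond ∅ (by simp)
  have h2 : 1 ≤ sunCnt G A := one_le_cnt h.conn hs
  simp at h1
  omega

/-- The components left in `G[H]` after deleting `S` give components of `G[A]`, where `A` arises
from `H` by adding pendant vertices. -/
theorem isComp_thicken (hA : A = thicken f H) (hp : IsPendantMap G H f)
    (hf : ∀ a ∈ H, ∀ b ∈ A, G.Adj (f a) b → b = a) (hS : S ⊆ H) (hC : IsComp G (H \ S) C) :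
    IsComp G (A \ S) (thicken f C) := by
  have hCH : ∀ c ∈ C, c ∈ H ∧ c ∉ S := fun c hc => Finset.mem_sdiff.1 (hC.1.1 hc)
  have hin : ∀ a ∈ H, a ∈ A ∧ f a ∈ A := fun a ha => by
    rw [hA, mem_thicken, mem_thicken]
    exact ⟨Or.inl ha, Or.inr ⟨a, ha, rfl⟩⟩
  refine ⟨⟨fun v hv => ?_, fun v hv b hb hvb => ?_⟩, ?_, fun B hB hBC hne => ?_⟩
  · rw [Finset.mem_sdiff]
    rcases mem_thicken.1 hv with hv | ⟨a, ha, rfl⟩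
    · exact ⟨(hin v (hCH v hv).1).1, (hCH v hv).2⟩
    · exact ⟨(hin a (hCH a ha).1).2, fun h => hp.notMem a (hCH a ha).1 (hS h)⟩
  · rw [Finset.mem_sdiff] at hb
    rcases mem_thicken.1 hv with hv | ⟨a, ha, rfl⟩
    · have hbA := hb.1
      rw [hA, mem_thicken] at hbA
      rcases hbA with hbH | ⟨a, ha, rfl⟩
      · exact mem_thicken.2 (Or.inl (hC.1.2 v hv b (Finset.mem_sdiff.2 ⟨hbH, hb.2⟩) hvb))
      · obtain rfl := hf a ha v (hin v (hCH v hv).1).1 hvb.symm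
        exact mem_thicken.2 (Or.inr ⟨v, hv, rfl⟩)
    · obtain rfl := hf a (hCH a ha).1 b hb.1 hvb
      exact mem_thicken.2 (Or.inl ha)
  · obtain ⟨c, hc⟩ := hC.2.1
    exact ⟨c, mem_thicken.2 (Or.inl hc)⟩
  · have hBH : Closed G (H \ S) (B ∩ H) := by
      refine ⟨fun v hv => ?_, fun v hv b hb hvb => ?_⟩
      · rw [Finset.mem_inter] at hv
        exact Finset.mem_sdiff.2 ⟨hv.2, (Finset.mem_sdiff.1 (hB.1 hv.1)).2⟩
      · rw [Finset.mem_inter] at hv ⊢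
        rw [Finset.mem_sdiff] at hb
        exact ⟨hB.2 v hv.1 b (Finset.mem_sdiff.2 ⟨(hin b hb.1).1, hb.2⟩) hvb, hb.1⟩
    have hBC' : B ∩ H ⊆ C := by
      intro v hv
      rw [Finset.mem_inter] at hv
      rcases mem_thicken.1 (hBC hv.1) with h | ⟨a, ha, rfl⟩
      · exact h
      · exact absurd hv.2 (hp.notMem a (hCH a ha).1)
    have hne' : (B ∩ H).Nonempty := by
      obtain ⟨v, hv⟩ := hne
      rcases mem_thicken.1 (hBC hv) with h | ⟨a, ha, rfl⟩
      · exact ⟨v, Finset.mem_inter.2 ⟨hv, (hCH v h).1⟩⟩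
      · refine ⟨a, Finset.mem_inter.2 ⟨hB.2 _ hv a ?_ (hp.adj a (hCH a ha).1).symm, (hCH a ha).1⟩⟩
        exact Finset.mem_sdiff.2 ⟨(hin a (hCH a ha).1).1, (hCH a ha).2⟩
    have heq := hC.2.2 _ hBH hBC' hne'
    refine hBC.antisymm fun v hv => ?_
    have hCB : ∀ c ∈ C, c ∈ B := fun c hc => (Finset.mem_inter.1 (heq ▸ hc)).1
    rcases mem_thicken.1 hv with h | ⟨a, ha, rfl⟩
    · exact hCB v h
    · refine hB.2 a (hCB a ha) _ (Finset.mem_sdiff.2 ⟨(hin a (hCH a ha).1).2, fun h => ?_⟩)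
        (hp.adj a (hCH a ha).1)
      exact hp.notMem a (hCH a ha).1 (hS h)

/-- A graph all of whose vertices carry exactly one pendant vertex, or are one. -/
theorem pathCover_thicken (hcond : SunCond G A) (hA : A = thicken f H) (hp : IsPendantMap G H f)
    (hf : ∀ a ∈ H, ∀ b ∈ A, G.Adj (f a) b → b = a) : PathCover G A := by
  rcases hasPM_or_exists_violator (G := G) H with hm | ⟨S, hS, hlt⟩
  · exact hA ▸ hp.pathCover hm
  exfalso
  have hin : ∀ a ∈ H, a ∈ A ∧ f a ∈ A := fun a ha => by
    rw [hA, mem_thicken, mem_thicken]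
    exact ⟨Or.inl ha, Or.inr ⟨a, ha, rfl⟩⟩
  have hCH : ∀ C ∈ comps G (FactorCritical G) (H \ S), ∀ c ∈ C, c ∈ H := fun C hC c hc =>
    (Finset.mem_sdiff.1 ((mem_comps.1 hC).1.1.1 hc)).1
  -- Deleting a violator `S` of `H` isolates the |S| pendant vertices at `S` and turns each
  -- factor-critical component of `H - S` into a corona, more than 2|S| suns in all.
  have hcard : (S.image (fun s => ({f s} : Finset V)) ∪
      (comps G (FactorCritical G) (H \ S)).image (thicken f)).card =
      S.card + cnt G (FactorCritical G) (H \ S) := by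
    rw [Finset.card_union_of_disjoint, Finset.card_image_of_injOn, Finset.card_image_of_injOn, cnt]
    · intro C hC D hD hCD
      have key : ∀ C ∈ comps G (FactorCritical G) (H \ S),
          ∀ D ∈ comps G (FactorCritical G) (H \ S), thicken f C = thicken f D → C ⊆ D := by
        intro C hC D hD hCD c hc
        have h1 : c ∈ thicken f D := hCD ▸ mem_thicken.2 (Or.inl hc)
        rcases mem_thicken.1 h1 with h | ⟨a, ha, rfl⟩
        · exact h
        · exact absurd (hCH C hC _ hc) (hp.notMem a (hCH D hD a ha))
      exact (key C hC D hD hCD).antisymm (key D hD C hC hCD.symm)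
    · intro s hs t ht hst
      exact hp.inj s (hS hs) t (hS ht) (Finset.singleton_injective hst)
    · rw [Finset.disjoint_left]
      intro D hD hD'
      obtain ⟨s, hs, rfl⟩ := Finset.mem_image.1 hD
      obtain ⟨C, hC, hCs⟩ := Finset.mem_image.1 hD'
      obtain ⟨c, hc⟩ := (mem_comps.1 hC).1.2.1
      have : c ∈ ({f s} : Finset V) := hCs ▸ mem_thicken.2 (Or.inl hc)
      rw [Finset.mem_singleton] at this
      exact hp.notMem s (hS hs) (this ▸ hCH C hC c hc)
  have h1 := card_le_cnt (G := G) (A := A \ S) (p := Sun G)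
    (F := S.image (fun s => ({f s} : Finset V)) ∪
      (comps G (FactorCritical G) (H \ S)).image (thicken f)) (by
    intro D hD
    rcases Finset.mem_union.1 hD with hD | hD
    · obtain ⟨s, hs, rfl⟩ := Finset.mem_image.1 hD
      refine ⟨isComp_singleton (Finset.mem_sdiff.2 ⟨(hin s (hS hs)).2, fun h =>
        hp.notMem s (hS hs) (hS h)⟩) fun b hb hsb => ?_, Or.inl ⟨_, rfl⟩⟩
      rw [Finset.mem_sdiff] at hb
      exact hb.2 (hf s (hS hs) b hb.1 hsb ▸ hs)
    · obtain ⟨C, hC, rfl⟩ := Finset.mem_image.1 hD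
      obtain ⟨hC', hfc⟩ := mem_comps.1 hC
      refine ⟨isComp_thicken hA hp hf hS hC', Or.inr ⟨C, f, rfl, hC'.2.1, ?_, ?_, ?_, hfc⟩⟩
      · exact fun a ha b hb => hp.inj a (hCH C hC a ha) b (hCH C hC b hb)
      · exact fun a ha ha' => hp.notMem a (hCH C hC a ha) (hCH C hC _ ha')
      · intro a ha w hw
        have haH := hCH C hC a ha
        refine ⟨hf a haH w ?_, fun h => h ▸ (hp.adj a haH).symm⟩
        rw [hA]
        exact thicken_mono (hCH C hC) hw)
  rw [hcard] at h1
  have h2 := hcond S (fun s hs => (hin s (hS hs)).1)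
  unfold sunCnt at h2
  omega

theorem Reduced.pathCover_of_leaves (h : Reduced G A)
    (hleaf : ∀ x ∈ A, (∃ u ∈ A, ∀ b ∈ A, G.Adj x b ↔ b = u) ∨
      ∃ z ∈ A, ∀ b ∈ A, G.Adj z b ↔ b = x) : PathCover G A := by
  classical
  let H := A.filter fun x => ∃ z ∈ A, ∀ b ∈ A, G.Adj z b ↔ b = x
  let f : V → V := fun x => if hx : ∃ z ∈ A, ∀ b ∈ A, G.Adj z b ↔ b = x then hx.choose else x
  have hf : ∀ x ∈ H, f x ∈ A ∧ ∀ b ∈ A, G.Adj (f x) b ↔ b = x := by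
    intro x hx
    have hx' := (Finset.mem_filter.1 hx).2
    simp only [f, dif_pos hx']
    exact hx'.choose_spec
  have hHA : ∀ x ∈ H, x ∈ A := fun x hx => (Finset.mem_filter.1 hx).1
  have hadj : ∀ x ∈ H, G.Adj x (f x) := fun x hx =>
    (((hf x hx).2 x (hHA x hx)).2 rfl).symm
  have hp : IsPendantMap G H f := by
    refine ⟨fun a ha b hb hab => ?_, fun x hx hfx => ?_, hadj⟩
    · refine ((hf b hb).2 a (hHA a ha)).1 ?_
      rw [← hab]
      exact (hadj a ha).symm
    -- If `f x` also carried a leaf, `x` and `f x` would be each other's only neighbour, so the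
    -- connected graph would be K_2, a sun.
    · have h1 : f (f x) = x := ((hf x hx).2 _ (hf _ hfx).1).1 (hadj _ hfx)
      have h2 := (hf _ hfx).2
      rw [h1] at h2
      have hcl : Closed G A {x, f x} := by
        refine ⟨?_, fun a ha b hb hab => ?_⟩
        · simp [Finset.insert_subset_iff, hHA x hx, (hf x hx).1]
        · simp only [Finset.mem_insert, Finset.mem_singleton] at ha ⊢
          rcases ha with rfl | rfl
          · exact Or.inr ((h2 b hb).1 hab)
          · exact Or.inl (((hf x hx).2 b hb).1 hab)
      have hA := (isComp_self_iff.1 h.conn).2 _ hcl (by simp)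
      have hne := (hadj x hx).ne
      refine h.not_sun (Or.inr ⟨{x}, f, ?_, by simp, by simp, by simpa using hne.symm, ?_, ?_⟩)
      · rw [← hA, thicken_singleton]
      · simpa using (hf x hx).2
      · intro v hv
        rw [Finset.mem_singleton.1 hv, Finset.erase_singleton]
        exact HasPM.empty
  refine pathCover_thicken h.cond ?_ hp fun a ha b hb => ((hf a ha).2 b hb).1
  ext v
  rw [mem_thicken]
  constructor
  · intro hv
    rcases hleaf v hv with ⟨u, hu, huv⟩ | hv'
    · have huH : u ∈ H := Finset.mem_filter.2 ⟨hu, v, hv, huv⟩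
      refine Or.inr ⟨u, huH, ?_⟩
      by_contra hne
      -- Two leaves at `u` would become two isolated suns when `u` is deleted, making `{u}` tight.
      have hsl := h.slack {u} (by simpa) (by simp)
      have h2 := card_le_cnt (G := G) (A := A \ {u}) (p := Sun G) (F := {{f u}, {v}}) (by
        intro D hD
        have key : ∀ z ∈ A, (∀ b ∈ A, G.Adj z b ↔ b = u) → IsComp G (A \ {u}) {z} ∧ Sun G {z} := by
          intro z hz hzu
          refine ⟨isComp_singleton ?_ ?_, Or.inl ⟨z, rfl⟩⟩
          · rw [Finset.mem_sdiff, Finset.mem_singleton]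
            refine ⟨hz, ?_⟩
            rintro rfl
            exact G.irrefl ((hzu z hz).2 rfl)
          · intro b hb hzb
            rw [Finset.mem_sdiff, Finset.mem_singleton] at hb
            exact hb.2 ((hzu b hb.1).1 hzb)
        simp only [Finset.mem_insert, Finset.mem_singleton] at hD
        rcases hD with rfl | rfl
        · exact key _ (hf u huH).1 (hf u huH).2
        · exact key v hv huv)
      rw [Finset.card_pair (by simpa using hne)] at h2
      simp only [Finset.card_singleton, sunCnt] at hsl
      omega
    · exact Or.inl (Finset.mem_filter.2 ⟨hv, hv'⟩)
  · rintro (hv | ⟨a, ha, rfl⟩)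
    exacts [hHA v hv, (hf a ha).1]

/-- **Kaneko's theorem**: if deleting a vertex set `S` never leaves more than `2|S|` suns, then the
graph can be covered by disjoint paths with at least three vertices. -/
theorem SunCond.pathCover (h : SunCond G A) : PathCover G A := by
  -- This measure drops both for proper subsets and for the deletion of an edge.
  induction hn : A.card + (adjPairs G A).card using Nat.strong_induction_on generalizing G A with
  | _ n ih =>
  subst hn
  rcases A.eq_empty_or_nonempty with rfl | ⟨v, hv⟩
  · exact PathCover.empty
  have IH : ∀ B, B ⊂ A → SunCond G B → PathCover G B := fun B hB hBc =>
    ih _ (add_lt_add_of_lt_of_le (Finset.card_lt_card hB)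
      (Finset.card_le_card (adjPairs_mono hB.1))) hBc rfl
  obtain ⟨C, hC, hvC⟩ := exists_isComp (G := G) hv
  by_cases hCA : C = A
  swap
  · have split : ∀ B, Closed G A B → B ⊂ A → PathCover G B := by
      intro B hB hBA
      refine IH B hBA fun X hX => ?_
      have h1 : sunCnt G (A \ X) = sunCnt G (B \ X) + _ := cnt_add_cnt (hB.delete X)
      have h2 := h X (hX.trans hB.1)
      omega
    have h1 := split C hC.1 (Finset.ssubset_iff_subset_ne.2 ⟨hC.1.1, hCA⟩)
    have h2 := split (A \ C) hC.1.sdiff (Finset.sdiff_ssubset hC.1.1 hC.2.1)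
    have h3 := h1.union Finset.disjoint_sdiff h2
    rwa [Finset.union_sdiff_of_subset hC.1.1] at h3
  subst hCA
  by_cases htight : ∃ S ⊆ C, S.Nonempty ∧ sunCnt G (C \ S) = 2 * S.card
  · obtain ⟨S, hS, hne, heq⟩ := htight
    exact pathCover_of_tight IH h hS hne heq
  push Not at htight
  have hred : Reduced G C :=
    ⟨IH, h, fun S hS hne => lt_of_le_of_ne (h S hS) (htight S hS hne), hC⟩
  by_cases hleaf : ∀ x ∈ C, (∃ u ∈ C, ∀ b ∈ C, G.Adj x b ↔ b = u) ∨
      ∃ z ∈ C, ∀ b ∈ C, G.Adj z b ↔ b = x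
  · exact hred.pathCover_of_leaves hleaf
  simp only [not_forall, not_or] at hleaf
  obtain ⟨x, hx, hx1, hx2⟩ := hleaf
  obtain ⟨y, hy, hxy⟩ : ∃ y ∈ C, G.Adj x y := by
    by_contra! hcon
    have := (isComp_self_iff.1 hC).2 _ (isComp_singleton hx hcon).1 (by simp)
    exact hred.not_sun (Or.inl ⟨x, this.symm⟩)
  have hx1' : ¬ ∀ b ∈ C, G.Adj x b ↔ b = y := fun h' => hx1 ⟨y, hy, h'⟩
  have hx2' : ∀ z ∈ C, ¬ ∀ b ∈ C, G.Adj z b ↔ b = x := fun z hz h' => hx2 ⟨z, hz, h'⟩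
  by_cases hdel : SunCond (delEdge G x y) C
  · exact (ih _ (Nat.add_lt_add_left (Finset.card_lt_card (adjPairs_delEdge_ssubset hx hy hxy)) _) hdel
      rfl).mono delEdge_le
  unfold SunCond at hdel
  push Not at hdel
  obtain ⟨S, hS, hlt⟩ := hdel
  rcases S.eq_empty_or_nonempty with rfl | hne
  · exact hred.pathCover_of_sun_delEdge hx hy hxy hx1' hx2' (by simpa using hlt)
  · exact hred.pathCover_of_cut hy hxy hx1' hx2' hS hne hlt

end PathFactor

/-! ### Translation to path factors and suns of induced graphs -/

namespace PathFactor

theorem mem_of_reachable {W : Type*} {F : SimpleGraph W} {T : Set W}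
    (hT : ∀ a ∈ T, ∀ b, F.Adj a b → b ∈ T) {a b : W} (h : F.Reachable a b) (ha : a ∈ T) :
    b ∈ T := by
  obtain ⟨p⟩ := h
  induction p with
  | nil => exact ha
  | cons hab _ ih => exact ih (hT _ ha _ hab)

variable {V : Type*}

section Paths

variable [DecidableEq V] {G : SimpleGraph V} {A : Finset V}

theorem PathCover.exists_family (h : PathCover G A) :
    ∃ L : Set (List V), (∀ l ∈ L, IsPathList G l ∧ 3 ≤ l.length) ∧
      (∀ v, v ∈ A ↔ ∃ l ∈ L, v ∈ l) ∧ ∀ l ∈ L, ∀ l' ∈ L, ∀ v ∈ l, v ∈ l' → l = l' := by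
  induction h with
  | empty => exact ⟨∅, by simp, by simp, by simp⟩
  | @cons A l hl h3 hd _ ih =>
    obtain ⟨L, h1, h2, h4⟩ := ih
    rw [Finset.disjoint_left] at hd
    have key : ∀ l' ∈ L, ∀ v ∈ l, v ∉ l' := fun l' hl' v hv hv' =>
      hd (List.mem_toFinset.2 hv) ((h2 v).2 ⟨l', hl', hv'⟩)
    refine ⟨insert l L, ?_, fun v => ?_, ?_⟩
    · rintro l' (rfl | hl')
      exacts [⟨hl, h3⟩, h1 l' hl']
    · simp [h2 v]
    · rintro l₁ (rfl | hl₁) l₂ (rfl | hl₂) v hv hv'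
      · rfl
      · exact absurd hv' (key l₂ hl₂ v hv)
      · exact absurd hv (key l₁ hl₁ v hv')
      · exact h4 l₁ hl₁ l₂ hl₂ v hv hv'

theorem PathCover.hasPathFactor (h : PathCover G A) {s : Set V} (hs : ∀ v, v ∈ A ↔ v ∈ s) :
    HasPathFactor 3 (G.induce s) := by
  obtain ⟨L, hL, hA, hdis⟩ := h.exists_family
  have hmem : ∀ l ∈ L, ∀ v ∈ l, v ∈ s := fun l hl v hv => (hs v).1 ((hA v).2 ⟨l, hl, hv⟩)
  -- Edges of `F` join consecutive entries of a list; since the lists are disjoint, the component of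
  -- `a` is exactly the list through `a`.
  let F : SimpleGraph s :=
    { Adj := fun a b => ∃ l ∈ L, ∃ i j : Fin l.length,
        (SimpleGraph.pathGraph l.length).Adj i j ∧ l[i] = a.1 ∧ l[j] = b.1
      symm := ⟨fun a b ⟨l, hl, i, j, hij, ha, hb⟩ => ⟨l, hl, j, i, hij.symm, hb, ha⟩⟩
      loopless := ⟨fun a ⟨l, hl, i, j, hij, ha, hb⟩ => hij.ne
        (Fin.ext (((hL l hl).1.2.getElem_inj_iff).1 (ha.trans hb.symm)))⟩ }
  refine ⟨F, ?_, ?_⟩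
  · rintro a b ⟨l, hl, i, j, hij, ha, hb⟩
    change G.Adj a.1 b.1
    rw [← ha, ← hb]
    have hch := List.isChain_iff_getElem.1 (hL l hl).1.1
    rw [SimpleGraph.pathGraph_adj] at hij
    rcases hij with hij | hij
    · have := hch i (by omega)
      simpa [hij] using this
    · have := (hch j (by omega)).symm
      simpa [hij] using this
  · intro C
    induction C using SimpleGraph.ConnectedComponent.ind with
    | h a =>
    obtain ⟨l, hl, hal⟩ := (hA a.1).1 ((hs a.1).2 a.2)
    obtain ⟨⟨hch, hnd⟩, h3⟩ := hL l hl
    let φ : Fin l.length → s := fun i => ⟨l[i], hmem l hl _ (List.getElem_mem i.2)⟩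
    have hφinj : Function.Injective φ := fun i j hij =>
      Fin.ext ((hnd.getElem_inj_iff).1 (congrArg Subtype.val hij))
    have hφadj : ∀ i j, F.Adj (φ i) (φ j) ↔ (SimpleGraph.pathGraph l.length).Adj i j := by
      intro i j
      constructor
      · rintro ⟨l', hl', i', j', hij, hi, hj⟩
        obtain rfl : l' = l := hdis l' hl' l hl l[i] (hi ▸ List.getElem_mem i'.2)
          (List.getElem_mem i.2)
        have h1 : i' = i := Fin.ext ((hnd.getElem_inj_iff).1 hi)
        have h2 : j' = j := Fin.ext ((hnd.getElem_inj_iff).1 hj)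
        rwa [← h1, ← h2]
      · exact fun hij => ⟨l, hl, i, j, hij, rfl, rfl⟩
    obtain ⟨k, hk, hka⟩ := List.getElem_of_mem hal
    have hka' : φ ⟨k, hk⟩ = a := Subtype.ext hka
    let ψ : SimpleGraph.pathGraph l.length →g F := ⟨φ, fun {i j} h => (hφadj i j).2 h⟩
    have hreach : ∀ i, F.Reachable (φ i) a := fun i => by
      have := (SimpleGraph.pathGraph_preconnected l.length i ⟨k, hk⟩).map ψ
      rwa [← hka']
    have hsurj : ∀ b, F.Reachable b a → ∃ i, φ i = b := by
      intro b hb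
      refine mem_of_reachable (T := Set.range φ) ?_ hb.symm ⟨_, hka'⟩
      rintro _ ⟨i, rfl⟩ c ⟨l', hl', i', j', hij, hi, hj⟩
      obtain rfl : l' = l := hdis l' hl' l hl l[i] (hi ▸ List.getElem_mem i'.2)
        (List.getElem_mem i.2)
      exact ⟨j', Subtype.ext hj⟩
    refine ⟨l.length, h3, ⟨SimpleGraph.Iso.symm ⟨Equiv.ofBijective
      (fun i => (⟨φ i, SimpleGraph.ConnectedComponent.eq.2 (hreach i)⟩ :
        (F.connectedComponentMk a).supp)) ⟨fun i j hij => hφinj (congrArg Subtype.val hij),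
          ?_⟩, ?_⟩⟩⟩
    · rintro ⟨b, hb⟩
      obtain ⟨i, rfl⟩ := hsurj b (SimpleGraph.ConnectedComponent.eq.1 hb)
      exact ⟨i, rfl⟩
    · intro i j
      exact hφadj i j

end Paths

section Suns

theorem exists_isPerfectMatching_of_involution {W : Type*} {F : SimpleGraph W} (m : W → W)
    (hm : ∀ a, m (m a) = a) (hadj : ∀ a, F.Adj a (m a)) :
    ∃ M : F.Subgraph, M.IsPerfectMatching := by
  let M : F.Subgraph :=
    { verts := Set.univ
      Adj := fun a b => m a = b
      adj_sub := fun {a b} hab => hab ▸ hadj a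
      edge_vert := fun _ => Set.mem_univ _
      symm := ⟨fun a b hab => hab ▸ hm a⟩ }
  exact ⟨M, fun a _ => ⟨m a, rfl, fun b hb => Eq.symm hb⟩, fun a => Set.mem_univ a⟩

variable [DecidableEq V] {G : SimpleGraph V} {A C H : Finset V} {f : V → V}

/-- The map `φ` identifies `F` with `G[C]`, and the core is renumbered by `Fin H.card`. The K_2
alternative is never needed, as it arises from a core with one vertex. -/
theorem Sun.isSun {W : Type*} {F : SimpleGraph W} (h : Sun G C) (φ : W → V)
    (hinj : Function.Injective φ) (hrange : ∀ v, v ∈ C ↔ ∃ w, φ w = v)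
    (hadj : ∀ a b, F.Adj a b ↔ G.Adj (φ a) (φ b)) : IsSun F := by
  rcases h with ⟨v, rfl⟩ | ⟨H, f, h⟩
  · obtain ⟨w, hw⟩ := (hrange v).1 (Finset.mem_singleton_self v)
    have hall : ∀ a, a = w := fun a => hinj (by
      rw [hw]
      exact Finset.mem_singleton.1 ((hrange _).2 ⟨a, rfl⟩))
    let _ : Unique W := ⟨⟨w⟩, hall⟩
    refine Or.inl ⟨⟨Equiv.ofUnique W (Fin 1), ?_⟩⟩
    intro a b
    rw [hall a, hall b]
    simp
  · right; right
    have hp := h.isPendantMap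
    have key : ∀ a ∈ H, a ∈ C ∧ f a ∈ C := fun a ha => by
      rw [h.eq, mem_thicken, mem_thicken]
      exact ⟨Or.inl ha, Or.inr ⟨a, ha, rfl⟩⟩
    let e : Fin H.card ≃ H := H.equivFin.symm
    let K : SimpleGraph (Fin H.card) := G.comap fun i => (e i : V)
    have heinj : ∀ i j, (e i : V) = e j → i = j := fun i j hij => e.injective (Subtype.ext hij)
    have hx : ∀ x : Fin H.card ⊕ Fin H.card,
        Sum.elim (fun i => (e i : V)) (fun i => f (e i)) x ∈ C := by
      rintro (i | i)
      exacts [(key _ (e i).2).1, (key _ (e i).2).2]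
    choose ψ hψ using fun x => (hrange _).1 (hx x)
    refine ⟨H.card, K, h.nonempty.card_pos, fun i => ?_, ⟨SimpleGraph.Iso.symm
      ⟨Equiv.ofBijective ψ ⟨fun x y hxy => ?_, fun w => ?_⟩, fun {x y} => ?_⟩⟩⟩
    · obtain ⟨m, hm⟩ := h.crit (e i) (e i).2
      have hmem : ∀ a : ((({i} : Finset (Fin H.card)) : Set (Fin H.card))ᶜ : Set _),
          (e a.1 : V) ∈ H.erase (e i) := by
        rintro ⟨a, ha⟩
        refine Finset.mem_erase.2 ⟨fun h' => ha ?_, (e a).2⟩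
        simpa using heinj a i h'
      refine exists_isPerfectMatching_of_involution
        (fun a => ⟨e.symm ⟨m (e a.1), Finset.mem_of_mem_erase (hm _ (hmem a)).1⟩, ?_⟩) ?_ ?_
      · intro h'
        have h1 := (hm _ (hmem a)).1
        simp only [Finset.coe_singleton, Set.mem_singleton_iff] at h'
        refine Finset.ne_of_mem_erase h1 ?_
        simpa using congrArg (fun j => (e j : V)) h'
      · intro a
        apply Subtype.ext
        apply e.injective
        apply Subtype.ext
        simp [(hm _ (hmem a)).2.1]
      · intro a
        have := (hm _ (hmem a)).2.2
        simpa [K] using this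
    · have h1 : Sum.elim (fun i => (e i : V)) (fun i => f (e i)) x =
          Sum.elim (fun i => (e i : V)) (fun i => f (e i)) y := by rw [← hψ, ← hψ, hxy]
      rcases x with i | i <;> rcases y with j | j
      · exact congrArg _ (heinj i j h1)
      · exact absurd h1.symm (hp.ne (e j).2 (e i).2)
      · exact absurd h1 (hp.ne (e i).2 (e j).2)
      · exact congrArg _ (heinj i j (hp.inj _ (e i).2 _ (e j).2 h1))
    · have hw := (hrange _).2 ⟨w, rfl⟩
      rw [h.eq, mem_thicken] at hw
      rcases hw with hw | ⟨a, ha, haw⟩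
      · exact ⟨Sum.inl (e.symm ⟨φ w, hw⟩), hinj (by rw [hψ]; simp)⟩
      · exact ⟨Sum.inr (e.symm ⟨a, ha⟩), hinj (by rw [hψ]; simp [haw])⟩
    · change F.Adj (ψ x) (ψ y) ↔ _
      rw [hadj, hψ, hψ]
      rcases x with i | i <;> rcases y with j | j
      · rfl
      · simp only [Sum.elim_inl, Sum.elim_inr, addPendants]
        rw [SimpleGraph.adj_comm, h.adj_iff _ (e j).2 _ (key _ (e i).2).1]
        exact ⟨heinj i j, fun h' => h' ▸ rfl⟩
      · simp only [Sum.elim_inl, Sum.elim_inr, addPendants]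
        rw [h.adj_iff _ (e i).2 _ (key _ (e j).2).1]
        exact ⟨fun h' => heinj i j h'.symm, fun h' => h' ▸ rfl⟩
      · simp only [Sum.elim_inr, addPendants, iff_false]
        rw [h.adj_iff _ (e i).2 _ (key _ (e j).2).2]
        exact hp.ne (e j).2 (e i).2

/-- Components in the sense of `IsComp` are the vertex sets of connected components. -/
theorem IsComp.mem_iff_reachable {s : Set V} (hs : ∀ v, v ∈ A ↔ v ∈ s) (hC : IsComp G A C)
    {v w : s} (hv : v.1 ∈ C) : w.1 ∈ C ↔ (G.induce s).Reachable w v := by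
  classical
  constructor
  · intro hw
    let B := A.filter fun u => ∃ hu : u ∈ s, (G.induce s).Reachable ⟨u, hu⟩ v
    have hB : Closed G A B := by
      refine ⟨Finset.filter_subset _ _, fun a ha b hb hab => ?_⟩
      obtain ⟨-, has, hav⟩ := Finset.mem_filter.1 ha
      refine Finset.mem_filter.2 ⟨hb, (hs b).1 hb, ?_⟩
      have : (G.induce s).Adj ⟨b, (hs b).1 hb⟩ ⟨a, has⟩ := hab.symm
      exact this.reachable.trans hav
    have := hC.subset_of_mem hB hv
      (Finset.mem_filter.2 ⟨(hs _).2 v.2, v.2, SimpleGraph.Reachable.refl _⟩) hw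
    obtain ⟨-, hws, h⟩ := Finset.mem_filter.1 this
    exact h
  · intro h
    exact mem_of_reachable (T := {u : s | u.1 ∈ C})
      (fun a ha b hab => hC.1.2 a ha b ((hs _).2 b.2) hab) h.symm hv

/-- Distinct components contain no mutually reachable vertices, so a chosen vertex in each gives an
injection. Only this inequality is needed: many suns here must give many suns for the toughness. -/
theorem sunCnt_le_sun [Finite V] {s : Set V} (hs : ∀ v, v ∈ A ↔ v ∈ s) :
    sunCnt G A ≤ sun (G.induce s) := by
  have hex : ∀ C : comps G (Sun G) A, ∃ v : s, v.1 ∈ C.1 := by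
    rintro ⟨C, hC⟩
    obtain ⟨v, hv⟩ := (mem_comps.1 hC).1.2.1
    exact ⟨⟨v, (hs v).1 ((mem_comps.1 hC).1.1.1 hv)⟩, hv⟩
  choose g hg using hex
  have hsun : ∀ C : comps G (Sun G) A,
      IsSun ((G.induce s).connectedComponentMk (g C)).toSimpleGraph := by
    intro C
    obtain ⟨hC, hCs⟩ := mem_comps.1 C.2
    refine hCs.isSun (fun w => w.1.1) (fun a b hab => Subtype.ext (Subtype.ext hab)) (fun v => ?_)
      fun a b => Iff.rfl
    constructor
    · intro hv
      have hvs := (hs v).1 (hC.1.1 hv)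
      exact ⟨⟨⟨v, hvs⟩, SimpleGraph.ConnectedComponent.eq.2
        ((hC.mem_iff_reachable hs (w := ⟨v, hvs⟩) (hg C)).1 hv)⟩, rfl⟩
    · rintro ⟨w, rfl⟩
      exact (hC.mem_iff_reachable hs (hg C)).2 (SimpleGraph.ConnectedComponent.eq.1 w.2)
  have hle := Nat.card_le_card_of_injective
    (fun C : comps G (Sun G) A =>
      (⟨_, hsun C⟩ : {D : (G.induce s).ConnectedComponent // IsSun D.toSimpleGraph})) (by
      intro C D hCD
      have h1 := SimpleGraph.ConnectedComponent.eq.1 (congrArg Subtype.val hCD)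
      have h2 := ((mem_comps.1 D.2).1.mem_iff_reachable hs (hg D)).2 h1
      exact Subtype.ext ((mem_comps.1 C.2).1.eq_of_mem (mem_comps.1 D.2).1 (hg C) h2))
  simpa [sun, sunCnt, cnt] using hle

end Suns

end PathFactor

/-! ### Kaneko's condition from connectivity and sun toughness -/

namespace PathFactor

variable {V : Type*} {G : SimpleGraph V}

theorem preconnected_and_not_subsingleton {k : ℕ} (hκ : k < vertexConnectivity G) {T : Finset V}
    (hT : T.card ≤ k) :
    (deleteVerts G T).Preconnected ∧ ¬ ((T : Set V)ᶜ).Subsingleton := by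
  by_contra hcon
  have : vertexConnectivity G ≤ T.card := Nat.sInf_le ⟨T, rfl, by tauto⟩
  omega

theorem Closed.eq_of_preconnected [DecidableEq V] {A B T : Finset V}
    (hA : ∀ v, v ∈ A ↔ v ∉ T) (h : (deleteVerts G T).Preconnected) (hB : Closed G A B)
    (hne : B.Nonempty) : B = A := by
  refine hB.1.antisymm fun v hv => ?_
  obtain ⟨w, hw⟩ := hne
  exact mem_of_reachable (T := {u : ((T : Set V)ᶜ : Set V) | u.1 ∈ B})
    (fun a ha b hab => hB.2 a ha b ((hA _).2 b.2) hab)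
    (h ⟨w, (hA w).1 (hB.1 hw)⟩ ⟨v, (hA v).1 hv⟩) hw

theorem sunToughness_le (hG : G ≠ ⊤) {X : Finset V} (hX : 2 ≤ sun (deleteVerts G X)) :
    sunToughness G ≤ (X.card : ℝ≥0∞) / (sun (deleteVerts G X) : ℝ≥0∞) := by
  rw [sunToughness, if_neg hG]
  exact iInf₂_le X hX

/-- After cross-multiplication with n = 2x + 1 and m = l + x the claim is (2l - 1)(x - 1) ≥ 0. -/
theorem add_div_le_div_three {l x n m : ℕ} (hl : 1 ≤ l) (hx : 1 ≤ x) (hn : 2 * x + 1 ≤ n)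
    (hm : m ≤ l + x) : (m : ℝ≥0∞) / (n : ℝ≥0∞) ≤ ((l : ℝ≥0∞) + 1) / 3 := by
  have h1 : 3 * m ≤ (l + 1) * n := by
    obtain ⟨k, rfl⟩ := Nat.exists_eq_add_of_le hx
    obtain ⟨j, rfl⟩ := Nat.exists_eq_add_of_le hl
    nlinarith [Nat.zero_le (j * k)]
  rw [ENNReal.div_le_iff_le_mul (Or.inl (by norm_cast; omega)) (Or.inl (by simp)),
    ENNReal.mul_comm_div, ← mul_div_assoc, ENNReal.le_div_iff_mul_le (Or.inl (by simp))
      (Or.inl (by simp)), mul_comm]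
  exact_mod_cast h1

theorem sunCond_of_toughness [Fintype V] [DecidableEq V] {l : ℕ} (hl : 1 ≤ l)
    (hκ : l + 2 ≤ vertexConnectivity G) (hs : ((l : ℝ≥0∞) + 1) / 3 < sunToughness G)
    {T : Finset V} (hT : T.card = l) : SunCond G (Finset.univ \ T) := by
  intro S hS
  by_contra! hlt
  have hSpos : 1 ≤ S.card := by
    by_contra hcon
    obtain rfl : S = ∅ := by
      rw [← Finset.card_eq_zero]
      omega
    obtain ⟨hpre, hsub⟩ := preconnected_and_not_subsingleton (k := l + 1) hκ (T := T) (by omega)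
    rw [Finset.sdiff_empty, Finset.card_empty] at hlt
    obtain ⟨K, hK⟩ := Finset.card_pos.1 (show 0 < sunCnt G (Finset.univ \ T) by omega)
    obtain ⟨hK, hKs⟩ := mem_comps.1 hK
    have hKA := hK.1.eq_of_preconnected (by simp) hpre hK.2.1
    have hmem : ∀ v, v ∈ K ↔ v ∉ T := fun v => by rw [hKA]; simp
    rcases hKs with ⟨v, rfl⟩ | ⟨H, f, hc⟩
    · refine hsub fun a ha b hb => ?_
      have ha' := (hmem a).2 ha
      have hb' := (hmem b).2 hb
      rw [Finset.mem_singleton] at ha' hb'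
      rw [ha', hb']
    · obtain ⟨h, hh⟩ := hc.nonempty
      have hp := hc.isPendantMap
      have hfK : f h ∈ K := by
        rw [hc.eq, mem_thicken]
        exact Or.inr ⟨h, hh, rfl⟩
      -- Deleting the core vertex `h` as well isolates `f h`, with only l + 1 < κ vertices deleted.
      obtain ⟨hpre', hsub'⟩ := preconnected_and_not_subsingleton (k := l + 1) hκ (T := insert h T)
        ((Finset.card_insert_le _ _).trans (by omega))
      have hmem' : ∀ v, v ∈ K.erase h ↔ v ∉ insert h T := fun v => by
        rw [Finset.mem_erase, hmem, Finset.mem_insert, not_or]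
      have hcl : Closed G (K.erase h) {f h} := by
        refine ⟨by simpa using ⟨hp.ne hh hh, hfK⟩, fun a ha b hb hab => ?_⟩
        rw [Finset.mem_singleton.1 ha] at hab
        exact absurd ((hc.adj_iff h hh b (Finset.mem_of_mem_erase hb)).1 hab)
          (Finset.ne_of_mem_erase hb)
      have heq := hcl.eq_of_preconnected hmem' hpre' (by simp)
      refine hsub' fun a ha b hb => ?_
      have ha' := (hmem' a).2 ha
      have hb' := (hmem' b).2 hb
      rw [← heq, Finset.mem_singleton] at ha' hb'
      rw [ha', hb']
  have hle : sunCnt G ((Finset.univ \ T) \ S) ≤ sun (deleteVerts G (T ∪ S)) :=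
    sunCnt_le_sun (by simp)
  -- A complete graph has infinite toughness, but it never has two components after deletions.
  have hG : G ≠ ⊤ := by
    rintro rfl
    obtain ⟨C, hC, D, hD, hCD⟩ := Finset.one_lt_card.1
      (show 1 < sunCnt (⊤ : SimpleGraph V) ((Finset.univ \ T) \ S) by omega)
    obtain ⟨hC, -⟩ := mem_comps.1 hC
    obtain ⟨hD, -⟩ := mem_comps.1 hD
    obtain ⟨c, hc⟩ := hC.2.1
    obtain ⟨d, hd⟩ := hD.2.1
    by_cases hcd : c = d
    · exact hCD (hC.eq_of_mem hD hc (hcd ▸ hd))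
    · exact hCD (hC.eq_of_mem hD (hC.1.2 c hc d (hD.1.1 hd) hcd) hd)
  refine absurd (hs.trans_le ((sunToughness_le hG (X := T ∪ S) (by omega)).trans
    (add_div_le_div_three hl hSpos (by omega) ?_))) (lt_irrefl _)
  exact (Finset.card_union_le _ _).trans (by omega)

end PathFactor

theorem theorem2 {V : Type*} [Finite V] (G : SimpleGraph V) (l : ℕ) (hl : 1 ≤ l)
    (hκ : l + 2 ≤ PathFactor.vertexConnectivity G)
    (hs : ((l : ℝ≥0∞) + 1) / 3 < PathFactor.sunToughness G) :
    PathFactor.IsPathFactorCritical 3 l G := by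
  classical
  have := Fintype.ofFinite V
  intro T hT
  exact (PathFactor.sunCond_of_toughness hl hκ hs hT).pathCover.hasPathFactor (by simp)
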